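/- Let $f=\frac1m\sum_{i=1}^m f_i:\mathbb{R}^d\to\mathbb{R}$ ($m\ge 1$), where each $f_i$ is twice differentiable and is held by machine $i$; machine $1$ is the master. Assume that $f$ is standard self-concordant, i.e. $f$ is convex with continuous third derivatives and $|u^Tf'''(w)[u]u|\le 2\,(u^Tf''(w)u)^{3/2}$ for all $w,u\in\mathbb{R}^d$, and that $\lambda I\preceq f''(w)\preceq LI$ for all $w$, where $L\ge\lambda>0$. Let $w_\star$ be the minimizer of $f$, let $\beta=1/20$, $\omega(t)=t-\log(1+t)$, and let $\lceil t\rceil$ be the smallest nonnegative integer that is at least $t$. The algorithm DiSCO, with parameters $\rho,\mu\ge0$, runs as follows. (i) In one communication round it forms $w_0=\frac1m\sum_i\widehat w_i$, where $\widehat w_i$ minimizes $f_i(w)+\frac\rho2\|w\|_2^2$. (ii) For $k=0,1,2,\dots$: in one round the master obtains $f'(w_k)$ as the average of the $f_i'(w_k)$. With $H=f''(w_k)$, $P=f_1''(w_k)+\mu I$ and $\epsilon_k=\beta\sqrt{\lambda/L}\,\|f'(w_k)\|_2$, it runs the preconditioned conjugate gradient method (preconditioner $P$) on $Hv=f'(w_k)$,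 starting from $v^{(0)}=0$, for at least one iteration and until the residual satisfies $\|r^{(t+1)}\|_2\le\epsilon_k$. Each of these iterations takes one round, in which the products $Hu^{(t)}$ and $Hv^{(t)}$ are formed by averaging ($u^{(t)}$ is the search direction and $v^{(t)}$ the current approximation). With the resulting $v_k$ and $\delta_k=\sqrt{v_k^THv_k}$ it sets $w_{k+1}=w_k-\frac{1}{1+\delta_k}v_k$. Suppose that $\mu\ge\|f_1''(w_k)-f''(w_k)\|_2$ for every iterate $w_k$ that is generated. Then for every $\epsilon>0$ there is a number $T$ of communication rounds after which the current iterate $\widehat w$ satisfies $f(\widehat w)-f(w_\star)<\epsilon$, with $$T\le 1+\left(\left\lceil\frac{f(w_0)-f(w_\star)}{\frac12\omega(1/6)}\right\rceil+\left\lceil\log_2\frac{2\omega(1/6)}{\epsilon}\right\rceil\right)\left(2+\sqrt{1+\frac{2\mu}{\lambda}}\,\log\frac{2L}{\beta\lambda}\right).$$ If $\epsilon\le 0.68^2$, the same holds when the outer loop is stopped, with output $w_{k+1}$, as soon as $\delta_k\le(1-\beta)\sqrt\epsilon$. Moreover, there is a universal constant $C$ such that the right-hand side above is at most $$C\,\bigl(f(w_0)-f(w_\star)+\max\{1,\log(1/\epsilon)\}\bigr)\sqrt{1+\frac{2\mu}{\lambda}}\,\log\frac{2L}{\beta\lambda}.$$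 -/

import Mathlib

namespace DiSCO

noncomputable section

/-- The space `ℝ^d` with the Euclidean norm. -/
abbrev Vec (d : ℕ) : Type := EuclideanSpace ℝ (Fin d)

/-- The Hessian `f''(w)`, as a linear operator on `ℝ^d` (its operator norm is the spectral
norm of the Hessian matrix). -/
def hess {d : ℕ} (f : Vec d → ℝ) (w : Vec d) : Vec d →L[ℝ] Vec d :=
  fderiv ℝ (gradient f) w

/-- `f` has a gradient and a Hessian at every point. -/
structure TwiceDifferentiable {d : ℕ} (f : Vec d → ℝ) : Prop where
  differentiable : Differentiable ℝ f
  differentiable_gradient : Differentiable ℝ (gradient f)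

/-- `f` is self-concordant with parameter `M`. The line derivative of the Hessian is
`f'''(w)[u] = lim_{t → 0} (f''(w + t u) - f''(w)) / t`. -/
structure IsSelfConcordant {d : ℕ} (f : Vec d → ℝ) (M : ℝ) : Prop where
  contDiff : ContDiff ℝ 3 f
  convex : ConvexOn ℝ Set.univ f
  bound : ∀ w u : Vec d,
    |inner ℝ u ((lineDeriv ℝ (hess f) w u) u)| ≤ M * (inner ℝ u (hess f w u)) ^ (3 / 2 : ℝ)

/-- A standard self-concordant function is self-concordant with parameter `2`. -/
def IsStandardSelfConcordant {d : ℕ} (f : Vec d → ℝ) : Prop := IsSelfConcordant f 2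

/-- `f` is twice continuously differentiable and `lam I ⪯ f''(w) ⪯ L I` for all `w`,
where `L ≥ lam > 0`. -/
structure HessianBounds {d : ℕ} (f : Vec d → ℝ) (lam L : ℝ) : Prop where
  contDiff : ContDiff ℝ 2 f
  pos : 0 < lam
  le : lam ≤ L
  lower : ∀ w u : Vec d, lam * ‖u‖ ^ 2 ≤ inner ℝ u (hess f w u)
  upper : ∀ w u : Vec d, inner ℝ u (hess f w u) ≤ L * ‖u‖ ^ 2

/-- `ω(t) = t - log (1 + t)`. -/
def omega (t : ℝ) : ℝ := t - Real.log (1 + t)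

/-- The constant `β = 1/20`. -/
def beta : ℝ := 1 / 20

/-- The average of one vector from each of the `m` machines: the reply that the master obtains
in a communication round. -/
def aggregate {d m : ℕ} (x : Fin m → Vec d) : Vec d := (m : ℝ)⁻¹ • ∑ i, x i

/-- The overall objective `f = (1/m) ∑ f_i`. -/
def objective {d m : ℕ} (f : Fin m → Vec d → ℝ) (w : Vec d) : ℝ := (m : ℝ)⁻¹ * ∑ i, f i w

/-- The state of the master machine between two communication rounds. -/
inductive State (d : ℕ) : Type
  /-- Nothing has been communicated yet. -/
  | start : State d
  /-- The outer iterate `w = w_k` has been formed; its PCG run has not yet begun. -/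
  | outer (w : Vec d) : State d
  /-- PCG is running at the outer iterate `w = w_k` with tolerance `tol = ε_k` and current
  vectors `v^{(t)}, r^{(t)}, s^{(t)}, u^{(t)}`. -/
  | inner (w : Vec d) (tol : ℝ) (v r s u : Vec d) : State d
  /-- The stopping test has succeeded, and `w` is the output. -/
  | done (w : Vec d) : State d

/-- The outer iterate held in a state. -/
def State.iterate {d : ℕ} : State d → Option (Vec d)
  | .start => none
  | .outer w => some w
  | .inner w _ _ _ _ _ => some w
  | .done w => some w

/-- The preconditioner `P = f₁''(w) + μ I`, known to the master (which is machine `0` here). -/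
def precond {d m : ℕ} [NeZero m] (f : Fin m → Vec d → ℝ) (μ : ℝ) (w : Vec d) :
    Vec d →L[ℝ] Vec d :=
  hess (f 0) w + μ • ContinuousLinearMap.id ℝ (Vec d)

open Classical in
/-- One iteration of PCG, with the test that ends the PCG run: the machines have returned
`Hu = H u^{(t)}` and `Hv = H v^{(t)}`. When PCG ends, the damped Newton step is taken at once, and
then the outer loop ends if the number `δ_k` passes the stopping test `halt`.
(If the gradient vanishes, the first step size is `0 / 0 = 0`, and the Newton step is `0`.) -/
def pcgStep {d m : ℕ} [NeZero m] (f : Fin m → Vec d → ℝ) (μ : ℝ) (halt : ℝ → Prop)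
    (w : Vec d) (tol : ℝ) (v r s u Hu Hv : Vec d) : State d :=
  let α : ℝ := inner ℝ r s / inner ℝ u Hu
  let v' : Vec d := v + α • u
  let r' : Vec d := r - α • Hu
  if ‖r'‖ ≤ tol then
    let δ : ℝ := √(inner ℝ v' Hv + α * inner ℝ v' Hu)
    let w' : Vec d := w - (1 / (1 + δ)) • v'
    if halt δ then .done w' else .outer w'
  else
    let s' : Vec d := (precond f μ w).inverse r'
    let b : ℝ := inner ℝ r' s' / inner ℝ r s
    .inner w tol v' r' s' (s' + b • u)

/-- One communication round, followed by the computations of the master up to the next round.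
* First round: machine `i` sends its local solution `wHat i`; the average is `w₀`.
* Next round of an outer iteration: the master broadcasts `w`, machine `i` returns `f_i'(w)`, and
  the master initializes PCG with tolerance `β (lam/L)^{1/2} ‖f'(w)‖`.
* Each PCG iteration: the master broadcasts `u` and `v`, machine `i` returns `f_i''(w) u` and
  `f_i''(w) v`.
After the output nothing happens. -/
def round {d m : ℕ} [NeZero m] (f : Fin m → Vec d → ℝ) (wHat : Fin m → Vec d) (lam L μ : ℝ)
    (halt : ℝ → Prop) : State d → State d
  | .start => .outer (aggregate wHat)
  | .outer w =>
      let g : Vec d := aggregate fun i => gradient (f i) w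
      let s : Vec d := (precond f μ w).inverse g
      .inner w (beta * √(lam / L) * ‖g‖) 0 g s s
  | .inner w tol v r s u =>
      pcgStep f μ halt w tol v r s u
        (aggregate fun i => hess (f i) w u) (aggregate fun i => hess (f i) w v)
  | .done w => .done w

/-- The state of DiSCO after `T` communication rounds. -/
def run {d m : ℕ} [NeZero m] (f : Fin m → Vec d → ℝ) (wHat : Fin m → Vec d) (lam L μ : ℝ)
    (halt : ℝ → Prop) (T : ℕ) : State d :=
  (round f wHat lam L μ halt)^[T] .start

/-- The outer loop is never stopped: all iterates `w₀, w₁, …` are generated. -/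
def neverStop : ℝ → Prop := fun _ => False

/-- The stopping criterion `δ_k ≤ (1 - β) √ε`. -/
def stopTest (ε : ℝ) : ℝ → Prop := fun δ => δ ≤ (1 - beta) * √ε

/-- After some number `T ≤ B` of communication rounds, the iterate that the run holds satisfies
`F(w) - F(wStar) < ε`. -/
def FindsWithin {d : ℕ} (X : ℕ → State d) (F : Vec d → ℝ) (wStar : Vec d) (ε B : ℝ) : Prop :=
  ∃ T : ℕ, (T : ℝ) ≤ B ∧ ∃ w : Vec d, (X T).iterate = some w ∧ F w - F wStar < ε

end

end DiSCO

/-! DiSCO is a damped Newton method with inexact directions. At an iterate `w` put `H = f''(w)`, `z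
= H⁻¹ f'(w)`, `η = ‖z‖_H` (the Newton decrement), and let `v` be the PCG output with `δ = ‖v‖_H`.
The residual of `v` is orthogonal to `v`, so `⟨v, f'(w)⟩ = δ²`. The tolerance gives `‖z - v‖_H ≤ β
η`. Hence `(1 - β) η ≤ δ ≤ η`.

By self-concordance the inverse local norm of a direction is 1-Lipschitz along that direction, so a
step lowers `f` by at least `ω(δ)` (`IsApproxNewton.apply_dampedStep_le`). While `η > 1/6` this is
at least `ω(1/6)/2`, which accounts for the first ceiling. Once `η ≤ 1/6`, each step multiplies `η`
by at most `7/10` (`IsApproxNewton.newtonDecrement_dampedStep_le`). So `η²` at least halves, and it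
controls the gap by `apply_sub_le`: this is the second ceiling. The stopping test forces `η ≤ √ε`,
which makes the gap small in the same way.

For the cost of one direction, `‖f₁'' - f''‖ ≤ μ` implies `H ⪯ P ⪯ κ H` with `κ = 1 + 2μ/λ`. PCG
minimizes the `H`-norm of the error over the Krylov spaces of `P⁻¹ H`, and comparison with a
Chebyshev polynomial gives the relative error `2 exp(-n/√κ)` (`IsGalerkin.energy_le_exp`). Thus `⌈√κ
log(2L/(βλ))⌉` iterations reach the tolerance. The gradient round and the rounding up make the
summand `2`. -/

namespace DiSCO

/-! ### Energy norms of symmetric positive definite operators -/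

section Energy

variable {E : Type*} [NormedAddCommGroup E] [InnerProductSpace ℝ E]

/-- `H` is symmetric and positive definite. -/
structure IsSPD (H : E →L[ℝ] E) : Prop where
  symm : ∀ x y : E, inner ℝ x (H y) = inner ℝ y (H x)
  pos : ∀ x : E, x ≠ 0 → 0 < inner ℝ x (H x)

/-- The norm `‖x‖_H = √⟨x, H x⟩`. -/
noncomputable def energy (H : E →L[ℝ] E) (x : E) : ℝ := √(inner ℝ x (H x))

variable {H : E →L[ℝ] E}

lemma energy_nonneg (H : E →L[ℝ] E) (x : E) : 0 ≤ energy H x := Real.sqrt_nonneg _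

lemma IsSPD.nonneg (hH : IsSPD H) (x : E) : 0 ≤ inner ℝ x (H x) := by
  rcases eq_or_ne x 0 with rfl | hx
  · simp
  · exact (hH.pos x hx).le

lemma IsSPD.energy_sq (hH : IsSPD H) (x : E) : energy H x ^ 2 = inner ℝ x (H x) :=
  Real.sq_sqrt (hH.nonneg x)

lemma IsSPD.energy_pos (hH : IsSPD H) {x : E} (hx : x ≠ 0) : 0 < energy H x :=
  Real.sqrt_pos.2 (hH.pos x hx)

lemma energy_smul (H : E →L[ℝ] E) (c : ℝ) (x : E) : energy H (c • x) = |c| * energy H x := by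
  unfold energy
  rw [map_smul, inner_smul_left, inner_smul_right, ← Real.sqrt_sq_eq_abs,
    ← Real.sqrt_mul (sq_nonneg c)]
  congr 1
  simp only [conj_trivial]
  ring

lemma energy_neg (H : E →L[ℝ] E) (x : E) : energy H (-x) = energy H x := by
  simp [energy]

/-- Cauchy–Schwarz for the form of `H`: positivity at `⟨y, Hy⟩ x - ⟨x, Hy⟩ y`, divided by `⟨y, Hy⟩`.
-/
lemma IsSPD.inner_apply_sq_le (hH : IsSPD H) (x y : E) :
    (inner ℝ x (H y)) ^ 2 ≤ inner ℝ x (H x) * inner ℝ y (H y) := by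
  rcases eq_or_ne y 0 with rfl | hy
  · simp
  have hq := hH.pos y hy
  have h := hH.nonneg (inner ℝ y (H y) • x - inner ℝ x (H y) • y)
  simp only [map_sub, map_smul, inner_sub_left, inner_sub_right, inner_smul_left,
    inner_smul_right, conj_trivial, hH.symm y x] at h
  have : 0 ≤ inner ℝ y (H y) * (inner ℝ x (H x) * inner ℝ y (H y) - (inner ℝ x (H y)) ^ 2) := by
    nlinarith
  linarith [nonneg_of_mul_nonneg_right this hq]

lemma IsSPD.abs_inner_le (hH : IsSPD H) (x y : E) :
    |inner ℝ x (H y)| ≤ energy H x * energy H y := by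
  refine abs_le_of_sq_le_sq ?_ (mul_nonneg (energy_nonneg _ _) (energy_nonneg _ _))
  rw [mul_pow, hH.energy_sq, hH.energy_sq]
  exact hH.inner_apply_sq_le x y

lemma IsSPD.inner_le (hH : IsSPD H) (x y : E) :
    inner ℝ x (H y) ≤ energy H x * energy H y :=
  (le_abs_self _).trans (hH.abs_inner_le x y)

lemma IsSPD.energy_sq_add (hH : IsSPD H) (x y : E) :
    energy H (x + y) ^ 2 = energy H x ^ 2 + 2 * inner ℝ x (H y) + energy H y ^ 2 := by
  simp only [hH.energy_sq, map_add, inner_add_left, inner_add_right, hH.symm y x]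
  ring

lemma IsSPD.energy_sq_sub (hH : IsSPD H) (x y : E) :
    energy H (x - y) ^ 2 = energy H x ^ 2 - 2 * inner ℝ x (H y) + energy H y ^ 2 := by
  simp only [hH.energy_sq, map_sub, inner_sub_left, inner_sub_right, hH.symm y x]
  ring

lemma IsSPD.energy_add_le (hH : IsSPD H) (x y : E) :
    energy H (x + y) ≤ energy H x + energy H y := by
  refine le_of_sq_le_sq ?_ (add_nonneg (energy_nonneg _ _) (energy_nonneg _ _))
  rw [hH.energy_sq_add]
  nlinarith [hH.inner_le x y]

lemma mul_norm_sq_le_energy_sq (hH : IsSPD H) {lam : ℝ}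
    (hlow : ∀ u, lam * ‖u‖ ^ 2 ≤ inner ℝ u (H u)) (x : E) : lam * ‖x‖ ^ 2 ≤ energy H x ^ 2 := by
  rw [hH.energy_sq]; exact hlow x

/-- `‖H x‖² ≤ L ‖x‖_H²` if `H ⪯ L I`. -/
lemma IsSPD.norm_apply_sq_le (hH : IsSPD H) {L : ℝ} (hL : 0 < L)
    (hup : ∀ u, inner ℝ u (H u) ≤ L * ‖u‖ ^ 2) (x : E) : ‖H x‖ ^ 2 ≤ L * energy H x ^ 2 := by
  rcases eq_or_ne (H x) 0 with h0 | h0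
  · rw [h0]; simpa using mul_nonneg hL.le (sq_nonneg (energy H x))
  have h1 := hH.inner_apply_sq_le (H x) x
  rw [real_inner_self_eq_norm_sq, ← hH.energy_sq x] at h1
  have h2 := hup (H x)
  have h3 : 0 < ‖H x‖ ^ 2 := by positivity
  have h4 : (‖H x‖ ^ 2) ^ 2 ≤ (L * ‖H x‖ ^ 2) * energy H x ^ 2 :=
    h1.trans (mul_le_mul_of_nonneg_right h2 (sq_nonneg _))
  nlinarith

/-- `λ ‖x‖_H² ≤ ‖H x‖²` if `λ I ⪯ H`. -/
lemma IsSPD.mul_energy_sq_le (hH : IsSPD H) {lam : ℝ} (hlam : 0 < lam)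
    (hlow : ∀ u, lam * ‖u‖ ^ 2 ≤ inner ℝ u (H u)) (x : E) :
    lam * energy H x ^ 2 ≤ ‖H x‖ ^ 2 := by
  rcases eq_or_ne x 0 with rfl | hx
  · simp [energy]
  have h1 : energy H x ^ 2 ≤ ‖x‖ * ‖H x‖ := by
    rw [hH.energy_sq]; exact real_inner_le_norm x (H x)
  have h2 := mul_norm_sq_le_energy_sq hH hlow x
  have hx' : 0 < ‖x‖ := norm_pos_iff.2 hx
  have h3 : lam * ‖x‖ ≤ ‖H x‖ := by
    have : lam * ‖x‖ * ‖x‖ ≤ ‖H x‖ * ‖x‖ := by nlinarith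
    exact le_of_mul_le_mul_right this hx'
  calc lam * energy H x ^ 2 ≤ lam * (‖x‖ * ‖H x‖) := by gcongr
    _ = (lam * ‖x‖) * ‖H x‖ := by ring
    _ ≤ ‖H x‖ * ‖H x‖ := by gcongr
    _ = ‖H x‖ ^ 2 := by ring

lemma IsSPD.isInvertible [FiniteDimensional ℝ E] (hH : IsSPD H) : H.IsInvertible := by
  have hinj : Function.Injective H := by
    rw [injective_iff_map_eq_zero]
    intro x hx
    by_contra h0
    have := hH.pos x h0
    simp [hx] at this
  exact ⟨(LinearEquiv.ofInjectiveEndo (H : E →ₗ[ℝ] E) hinj).toContinuousLinearEquiv, by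
    ext x; rfl⟩

lemma IsSPD.inverse_symm [FiniteDimensional ℝ E] (hH : IsSPD H) (x y : E) :
    inner ℝ x (H.inverse y) = inner ℝ y (H.inverse x) := by
  have h := hH.symm (H.inverse y) (H.inverse x)
  rw [hH.isInvertible.self_apply_inverse, hH.isInvertible.self_apply_inverse] at h
  rw [real_inner_comm, h, real_inner_comm]

end Energy

/-! ### Polynomials in operators that are symmetric for some inner product -/

open Polynomial in
-- The operator is self-adjoint for the inner product `B`, so it has a `B`-orthonormal eigenbasis
-- with eigenvalues in `[a, b]`, on which `p(A)` acts by the values of `p`. A general form `B` is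
-- needed because `P⁻¹ H` is symmetric for the form of `H` but in general not for the Euclidean one.
lemma aeval_form_le {V : Type*} [AddCommGroup V] [Module ℝ V] [FiniteDimensional ℝ V]
    (B : V →ₗ[ℝ] V →ₗ[ℝ] ℝ) (hsymm : ∀ x y, B x y = B y x) (hpos : ∀ x, x ≠ 0 → 0 < B x x)
    (A : V →ₗ[ℝ] V) (hA : ∀ x y, B (A x) y = B x (A y)) {a b : ℝ}
    (hlow : ∀ x, a * B x x ≤ B x (A x)) (hup : ∀ x, B x (A x) ≤ b * B x x)
    (p : ℝ[X]) {M : ℝ} (hM : ∀ t ∈ Set.Icc a b, |p.eval t| ≤ M) (x : V) :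
    B (aeval A p x) (aeval A p x) ≤ M ^ 2 * B x x := by
  have hnonneg : ∀ x, 0 ≤ B x x := fun x => by
    rcases eq_or_ne x 0 with rfl | h
    · simp
    · exact (hpos x h).le
  let core : InnerProductSpace.Core ℝ V :=
    { inner := fun x y => B x y
      conj_inner_symm := fun x y => hsymm y x
      re_inner_nonneg := fun x => hnonneg x
      add_left := fun x y z => by simp
      smul_left := fun x y r => by simp
      definite := fun x hx => by
        by_contra h
        exact (hpos x h).ne' hx }
  let _ : NormedAddCommGroup V := core.toNormedAddCommGroup
  let _ : InnerProductSpace ℝ V := InnerProductSpace.ofCore core.toCore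
  have hB : ∀ x y : V, inner ℝ x y = B x y := fun _ _ => rfl
  have hAs : A.IsSymmetric := fun x y => hA x y
  set e := hAs.eigenvectorBasis rfl with he
  set ev := hAs.eigenvalues rfl with hev
  have hAe : ∀ i, A (e i) = ev i • e i := fun i => by
    exact hAs.apply_eigenvectorBasis rfl i
  have hmem : ∀ i, ev i ∈ Set.Icc a b := fun i => by
    have h1 := hlow (e i)
    have h2 := hup (e i)
    have h3 : B (e i) (e i) = 1 := by
      rw [← hB, real_inner_self_eq_norm_sq, e.norm_eq_one]; norm_num
    rw [hAe, map_smul, h3, smul_eq_mul] at h1 h2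
    constructor <;> linarith
  have hpe : ∀ i, aeval A p (e i) = p.eval (ev i) • e i := fun i =>
    Module.End.aeval_apply_of_hasEigenvector
      (hAs.hasEigenvector_eigenvectorBasis rfl i)
  have hexp : aeval A p x = ∑ i, (inner ℝ (e i) x * p.eval (ev i)) • e i := by
    conv_lhs => rw [← e.sum_repr' x]
    rw [map_sum]
    refine Finset.sum_congr rfl fun i _ => ?_
    rw [map_smul, hpe, smul_smul]
  rw [← hB, ← hB, real_inner_self_eq_norm_sq, real_inner_self_eq_norm_sq,
    ← e.sum_sq_norm_inner_right x, ← e.sum_sq_norm_inner_right, Finset.mul_sum]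
  refine Finset.sum_le_sum fun i _ => ?_
  rw [hexp, e.orthonormal.inner_right_fintype, norm_mul, mul_pow, mul_comm]
  gcongr
  exact hM _ (hmem i)

/-! ### The Chebyshev comparison polynomial -/

open Polynomial in
/-- On `[1/κ, 1]` the scaled Chebyshev polynomial is small, while its value at `0` is one. -/
lemma exists_polynomial_small {κ : ℝ} (hκ : 1 ≤ κ) (n : ℕ) :
    ∃ p : ℝ[X], p.natDegree ≤ n ∧ p.eval 0 = 1 ∧
      ∀ t ∈ Set.Icc (1 / κ) 1, |p.eval t| ≤ 2 * Real.exp (-(n / √κ)) := by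
  -- The choice `y² = 1/(2κ)` rather than `1/κ` keeps `1 - y` away from zero even for `κ = 1`. The
  -- lost factor `√2` is recovered in `hθy`, where `log((1+y)/(1-y)) ≥ 3y/2 ≥ √2 y`.
  set y : ℝ := 1 / √(2 * κ) with hy
  have hκ0 : 0 < κ := by linarith
  have hs : 0 < √(2 * κ) := Real.sqrt_pos.2 (by linarith)
  have hy0 : 0 < y := by positivity
  have hy2 : y ^ 2 = 1 / (2 * κ) := by
    rw [hy, div_pow, one_pow, Real.sq_sqrt (by linarith)]
  have hy2' : y ^ 2 ≤ 1 / 2 := by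
    rw [hy2]; apply one_div_le_one_div_of_le <;> linarith
  have hy1 : y < 3 / 4 := by nlinarith
  have hyκ : 1 / √κ = √2 * y := by
    rw [hy, Real.sqrt_mul (by norm_num)]
    field_simp
  set z : ℝ := (1 + y) / (1 - y) with hz
  have hz1 : 1 ≤ z := by rw [hz, le_div_iff₀] <;> linarith
  have hz0 : 0 < z := by linarith
  set θ : ℝ := Real.log z with hθ
  have hθy : 1 / √κ ≤ θ := by
    rw [hyκ, hθ, hz, Real.log_div (by linarith) (by linarith)]
    have h1 := Real.le_log_one_add_of_nonneg hy0.le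
    have h2 := Real.log_le_sub_one_of_pos (show (0 : ℝ) < 1 - y by linarith)
    have h3 : √2 ≤ 3 / 2 := by rw [Real.sqrt_le_left (by norm_num)]; norm_num
    have h4 : y / 2 ≤ 2 * y / (y + 2) := by
      rw [div_le_div_iff₀ (by norm_num) (by linarith)]; nlinarith
    nlinarith
  have hc : Real.cosh θ = (1 + y ^ 2) / (1 - y ^ 2) := by
    rw [hθ, Real.cosh_log hz0, hz]
    have : 1 - y ≠ 0 := by linarith
    have h' : 1 + y ≠ 0 := by linarith
    have h'' : 1 - y ^ 2 ≠ 0 := by linarith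
    field_simp
    ring
  set x₀ := (1 + y ^ 2) / (1 - y ^ 2) with hx₀
  -- The affine map that sends `[y², 1]` onto `[-1, 1]`, reversing it, and `0` to `x₀ = cosh θ`.
  -- There `T_n` takes the large value `cosh(nθ)`.
  set ℓ : ℝ[X] := C x₀ - C (2 / (1 - y ^ 2)) * X with hℓ
  have hD : Real.exp (n / √κ) / 2 ≤ (Chebyshev.T ℝ n).eval x₀ := by
    rw [← hc, Chebyshev.T_real_cosh, Real.cosh_eq]
    have : Real.exp (n / √κ) ≤ Real.exp (((n : ℤ) : ℝ) * θ) := by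
      apply Real.exp_le_exp.2
      rw [div_eq_mul_one_div]
      push_cast
      gcongr
    have h2 := Real.exp_pos (-(((n : ℤ) : ℝ) * θ))
    linarith
  have hD0 : 0 < (Chebyshev.T ℝ n).eval x₀ := lt_of_lt_of_le (by positivity) hD
  refine ⟨C ((Chebyshev.T ℝ n).eval x₀)⁻¹ * (Chebyshev.T ℝ n).comp ℓ, ?_, ?_, ?_⟩
  · refine (natDegree_C_mul_le _ _).trans ?_
    rw [natDegree_comp, Chebyshev.natDegree_T]
    have : ℓ.natDegree ≤ 1 := by
      rw [hℓ]
      compute_degree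
    simpa using Nat.mul_le_mul_left n this
  · simp only [eval_mul, eval_C, eval_comp, hℓ, eval_sub, eval_X, mul_zero, sub_zero]
    exact inv_mul_cancel₀ hD0.ne'
  · rintro t ⟨ht1, ht2⟩
    have hyt : y ^ 2 ≤ t := by
      refine le_trans ?_ ht1
      rw [hy2]
      apply one_div_le_one_div_of_le <;> linarith
    have hle : |ℓ.eval t| ≤ 1 := by
      have h1 : 0 < 1 - y ^ 2 := by linarith
      have : ℓ.eval t = (1 + y ^ 2 - 2 * t) / (1 - y ^ 2) := by
        simp [hℓ, hx₀]; field_simp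
      rw [this, abs_div, abs_of_pos h1, div_le_one h1, abs_le]
      constructor <;> linarith
    rw [eval_mul, eval_C, eval_comp, abs_mul, abs_inv, abs_of_pos hD0]
    have h1 : |(Chebyshev.T ℝ n).eval (ℓ.eval t)| ≤ 1 :=
      Chebyshev.abs_eval_T_real_le_one n hle
    calc ((Chebyshev.T ℝ n).eval x₀)⁻¹ * |(Chebyshev.T ℝ n).eval (ℓ.eval t)|
        ≤ (Real.exp (n / √κ) / 2)⁻¹ * 1 := by gcongr
      _ = 2 * Real.exp (-(n / √κ)) := by rw [Real.exp_neg]; field_simp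

/-! ### The preconditioned conjugate gradient method -/

section ConjugateGradient

variable {E : Type*} [NormedAddCommGroup E] [InnerProductSpace ℝ E]

/-- `v` is a Galerkin approximation of the solution of `H v = g` in a subspace `K` that contains
the first `n` Krylov vectors of `Q H`; `r` is its residual. -/
structure IsGalerkin (H Q : E →L[ℝ] E) (g : E) (n : ℕ) (v r : E) (K : Submodule ℝ E) : Prop where
  residual : r = g - H v
  mem : v ∈ K
  orth : ∀ k ∈ K, inner ℝ r k = 0
  krylov : ∀ j < n, ((Q ∘L H : E →L[ℝ] E) ^ j) (Q g) ∈ K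

/-- `u` is a search direction that is conjugate to `K` and extends it to the next Krylov space. -/
structure IsConjugate (H Q : E →L[ℝ] E) (g r u : E) (K : Submodule ℝ E) : Prop where
  conj : ∀ k ∈ K, inner ℝ u (H k) = 0
  sub_mem : u - Q r ∈ K
  apply_mem : ∀ k ∈ K, Q (H k) ∈ K ⊔ Submodule.span ℝ {u}
  base : Q g ∈ K ⊔ Submodule.span ℝ {u}

variable {H Q : E →L[ℝ] E} {g v r u : E} {n : ℕ} {K : Submodule ℝ E}

lemma isGalerkin_zero (H Q : E →L[ℝ] E) (g : E) : IsGalerkin H Q g 0 0 g ⊥ where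
  residual := by simp
  mem := Submodule.zero_mem _
  orth := by simp
  krylov := by simp

lemma isConjugate_zero (H Q : E →L[ℝ] E) (g : E) : IsConjugate H Q g g (Q g) ⊥ where
  conj := by simp
  sub_mem := by simp
  apply_mem := by simp
  base := by simp [Submodule.mem_span_singleton_self]

lemma IsGalerkin.inner_direction (hG : IsGalerkin H Q g n v r K)
    (hC : IsConjugate H Q g r u K) : inner ℝ r u = inner ℝ r (Q r) := by
  have := hG.orth _ hC.sub_mem
  rw [inner_sub_right] at this
  linarith

lemma IsGalerkin.direction_ne_zero (hQ : IsSPD Q) (hG : IsGalerkin H Q g n v r K)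
    (hC : IsConjugate H Q g r u K) (hr : r ≠ 0) : u ≠ 0 := by
  rintro rfl
  have h := hG.inner_direction hC
  have := hQ.pos r hr
  simp [← h] at this

/-- One step of the conjugate gradient method passes to the next Galerkin approximation. -/
lemma IsGalerkin.step (hH : IsSPD H) (hQ : IsSPD Q) (hG : IsGalerkin H Q g n v r K)
    (hC : IsConjugate H Q g r u K) (hr : r ≠ 0) {a : ℝ}
    (ha : a = inner ℝ r (Q r) / inner ℝ u (H u)) :
    IsGalerkin H Q g (n + 1) (v + a • u) (r - a • H u) (K ⊔ Submodule.span ℝ {u}) where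
  residual := by rw [hG.residual, map_add, map_smul]; abel
  mem := Submodule.add_mem_sup hG.mem
    (Submodule.smul_mem _ _ (Submodule.mem_span_singleton_self u))
  orth := by
    intro x hx
    obtain ⟨k, hk, y, hy, rfl⟩ := Submodule.mem_sup.1 hx
    obtain ⟨c, rfl⟩ := Submodule.mem_span_singleton.1 hy
    have hu : inner ℝ u (H u) ≠ 0 := (hH.pos u (hG.direction_ne_zero hQ hC hr)).ne'
    have h1 : inner ℝ (H u) k = 0 := by rw [real_inner_comm, hH.symm]; exact hC.conj k hk
    have h2 : inner ℝ (H u) u = inner ℝ u (H u) := real_inner_comm _ _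
    have h3 : a * inner ℝ u (H u) = inner ℝ r (Q r) := by rw [ha]; field_simp
    simp only [inner_sub_left, inner_add_right, inner_smul_left, inner_smul_right, conj_trivial,
      hG.orth k hk, h1, h2, hG.inner_direction hC, h3]
    ring
  krylov := by
    intro j hj
    rcases Nat.lt_succ_iff_lt_or_eq.1 hj with h | rfl
    · exact Submodule.mem_sup_left (hG.krylov j h)
    -- The new Krylov vector is `Q g` itself at the first step, and later the image under `Q H` of
    -- the last one in `K`.
    · cases j with
      | zero => simpa using hC.base
      | succ i =>
        rw [pow_succ']
        exact hC.apply_mem _ (hG.krylov i (Nat.lt_succ_self i))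

/-- One step of the conjugate gradient method yields the next conjugate direction. -/
lemma IsConjugate.step (hH : IsSPD H) (hQ : IsSPD Q) (hG : IsGalerkin H Q g n v r K)
    (hC : IsConjugate H Q g r u K) (hr : r ≠ 0) {a b : ℝ} {r' : E}
    (ha : a = inner ℝ r (Q r) / inner ℝ u (H u)) (hr' : r' = r - a • H u)
    (hb : b = inner ℝ r' (Q r') / inner ℝ r (Q r)) :
    IsConjugate H Q g r' (Q r' + b • u) (K ⊔ Submodule.span ℝ {u}) := by
  have hG' := hG.step hH hQ hC hr ha
  rw [← hr'] at hG'
  have hu : 0 < inner ℝ u (H u) := hH.pos u (hG.direction_ne_zero hQ hC hr)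
  have hrQ : 0 < inner ℝ r (Q r) := hQ.pos r hr
  have ha0 : 0 < a := by rw [ha]; positivity
  -- Products with `H u` become differences of residuals, whose orthogonality to the spaces is
  -- known.
  have hHu : H u = a⁻¹ • (r - r') := by
    rw [hr', sub_sub_cancel, smul_smul, inv_mul_cancel₀ ha0.ne', one_smul]
  have huK : u ∈ K ⊔ Submodule.span ℝ {u} :=
    Submodule.mem_sup_right (Submodule.mem_span_singleton_self u)
  have hQr : Q r ∈ K ⊔ Submodule.span ℝ {u} := by
    have := Submodule.sub_mem _ huK (Submodule.mem_sup_left hC.sub_mem)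
    rwa [sub_sub_cancel] at this
  refine ⟨?_, ?_, ?_, Submodule.mem_sup_left hC.base⟩
  · intro x hx
    obtain ⟨k, hk, y, hy, rfl⟩ := Submodule.mem_sup.1 hx
    obtain ⟨c, rfl⟩ := Submodule.mem_span_singleton.1 hy
    -- Why a short recurrence suffices: `Q H k` already lies in the enlarged space, to which `r'` is
    -- orthogonal. Only conjugacy to `u` remains, and `b` provides it.
    have h1 : inner ℝ (Q r') (H k) = 0 := by
      rw [real_inner_comm, hQ.symm]
      exact hG'.orth _ (hC.apply_mem k hk)
    have h2 : inner ℝ (Q r') (H u) = -(a⁻¹ * inner ℝ r' (Q r')) := by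
      rw [hHu, inner_smul_right, inner_sub_right, real_inner_comm r, hQ.symm,
        hG'.orth _ hQr, real_inner_comm r']
      ring
    have h3 : b * inner ℝ u (H u) = a⁻¹ * inner ℝ r' (Q r') := by
      rw [hb, ha]; field_simp
    simp only [map_add, map_smul, inner_add_left, inner_add_right, inner_smul_left,
      inner_smul_right, conj_trivial, h1, hC.conj k hk, h2]
    linear_combination c * h3
  · rw [add_sub_cancel_left]
    exact Submodule.smul_mem _ _ huK
  · intro x hx
    obtain ⟨k, hk, y, hy, rfl⟩ := Submodule.mem_sup.1 hx
    obtain ⟨c, rfl⟩ := Submodule.mem_span_singleton.1 hy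
    have hu' : Q r' + b • u ∈ (K ⊔ Submodule.span ℝ {u}) ⊔ Submodule.span ℝ {Q r' + b • u} :=
      Submodule.mem_sup_right (Submodule.mem_span_singleton_self _)
    have hQr' : Q r' ∈ (K ⊔ Submodule.span ℝ {u}) ⊔ Submodule.span ℝ {Q r' + b • u} := by
      have := Submodule.sub_mem _ hu' (Submodule.mem_sup_left (Submodule.smul_mem _ b huK))
      rwa [add_sub_cancel_right] at this
    rw [map_add, map_add, map_smul, map_smul, hHu, map_smul, map_sub]
    refine Submodule.add_mem _ (Submodule.mem_sup_left (hC.apply_mem k hk)) ?_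
    exact Submodule.smul_mem _ _ (Submodule.smul_mem _ _
      (Submodule.sub_mem _ (Submodule.mem_sup_left hQr) hQr'))

/-- Pythagoras in the `H`-norm: `⟨z - v, H(v - k)⟩ = ⟨r, v - k⟩ = 0`. -/
lemma IsGalerkin.energy_le (hH : IsSPD H) (hG : IsGalerkin H Q g n v r K) {z : E} (hz : H z = g)
    {k : E} (hk : k ∈ K) : energy H (z - v) ≤ energy H (z - k) := by
  refine le_of_sq_le_sq ?_ (energy_nonneg _ _)
  have h0 : inner ℝ (z - v) (H (v - k)) = 0 := by
    rw [hH.symm, map_sub, hz, ← hG.residual, real_inner_comm]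
    exact hG.orth _ (Submodule.sub_mem _ hG.mem hk)
  have h1 := hH.energy_sq_add (z - v) (v - k)
  rw [h0, sub_add_sub_cancel] at h1
  nlinarith [sq_nonneg (energy H (v - k))]

open Polynomial in
/-- The error of the conjugate gradient method in terms of the condition number `κ`
of `P⁻¹ H`. -/
lemma IsGalerkin.energy_le_exp [FiniteDimensional ℝ E] {P : E →L[ℝ] E} (hH : IsSPD H)
    (hP : IsSPD P) {κ : ℝ} (hκ : 1 ≤ κ) (hlow : ∀ x, inner ℝ x (H x) ≤ inner ℝ x (P x))
    (hup : ∀ x, inner ℝ x (P x) ≤ κ * inner ℝ x (H x))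
    (hG : IsGalerkin H P.inverse g n v r K) {z : E} (hz : H z = g) :
    energy H (z - v) ≤ 2 * Real.exp (-(n / √κ)) * energy H z := by
  obtain ⟨p, hdeg, hp0, hp⟩ := exists_polynomial_small hκ n
  set A : E →L[ℝ] E := P.inverse ∘L H with hA
  have hAz : A z = P.inverse g := by simp [hA, hz]
  have hPA : ∀ x, P (A x) = H x := fun x => hP.isInvertible.self_apply_inverse _
  have hκ0 : 0 < κ := by linarith
  -- As `p(0) = 1`, the constant terms cancel, and what remains is a combination of the Krylov
  -- vectors `A^j (P⁻¹ g)` with `j < n`. It is therefore an admissible competitor, with error `p(A)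
  -- z`.
  have hmem : z - aeval (A : E →ₗ[ℝ] E) p z ∈ K := by
    have hcoe : ∀ (j : ℕ) (x : E), ((A : E →ₗ[ℝ] E) ^ j) x = (A ^ j) x := by
      intro j
      induction j with
      | zero => intro x; simp
      | succ i ih => intro x; rw [pow_succ', pow_succ', Module.End.mul_apply, ih]; rfl
    rw [aeval_eq_sum_range' (Nat.lt_succ_of_le hdeg), Finset.sum_range_succ', LinearMap.add_apply,
      LinearMap.sum_apply]
    have h0 : (p.coeff 0 • (A : E →ₗ[ℝ] E) ^ 0) z = z := by
      rw [coeff_zero_eq_eval_zero, hp0]; simp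
    rw [h0, ← sub_sub, sub_right_comm, sub_self, zero_sub]
    refine Submodule.neg_mem _ (Submodule.sum_mem _ fun j hj => ?_)
    rw [LinearMap.smul_apply]
    refine Submodule.smul_mem _ _ ?_
    rw [hcoe, pow_succ]
    change (A ^ j) (A z) ∈ K
    rw [hAz]
    exact hG.krylov j (Finset.mem_range.1 hj)
  have hsym : ∀ x y, inner ℝ (A x) (H y) = inner ℝ x (H (A y)) := fun x y => by
    rw [hH.symm x, ← hPA y, ← hPA x, hP.symm]
  have hAA : ∀ x, inner ℝ x (H (A x)) = inner ℝ (A x) (P (A x)) := fun x => by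
    rw [← hsym, hPA]
  -- Cauchy–Schwarz for `H` together with `H ⪯ P` bounds the spectrum of `A` by `1`. Below,
  -- Cauchy–Schwarz for `P` together with `P ⪯ κ H` bounds it from below by `1/κ`.
  have hAup : ∀ x, inner ℝ x (H (A x)) ≤ inner ℝ x (H x) := fun x => by
    rw [hAA]
    have h1 := hH.inner_apply_sq_le (A x) x
    rw [← hPA x] at h1
    have h2 := hlow (A x)
    have h3 := hP.nonneg (A x)
    rw [hPA] at h1 h2 h3 ⊢
    have h4 := hH.nonneg x
    rcases h3.eq_or_lt with h | h
    · rw [← h]; exact h4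
    · nlinarith
  have hAlow : ∀ x, 1 / κ * inner ℝ x (H x) ≤ inner ℝ x (H (A x)) := fun x => by
    rw [hAA, one_div, inv_mul_le_iff₀ hκ0]
    have h1 := hP.inner_apply_sq_le x (A x)
    have h2 := hup x
    have h3 := hP.nonneg (A x)
    rw [hPA] at h1 h3 ⊢
    have h4 := hH.nonneg x
    rcases h4.eq_or_lt with h | h
    · rw [← h]; exact mul_nonneg hκ0.le h3
    · nlinarith
  have key := aeval_form_le
    (LinearMap.mk₂ ℝ (fun x y => inner ℝ x (H y)) (by intros; simp [inner_add_left])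
      (by intros; simp [inner_smul_left]) (by intros; simp [inner_add_right])
      (by intros; simp [inner_smul_right]))
    (fun x y => hH.symm x y) (fun x hx => hH.pos x hx) (A : E →ₗ[ℝ] E) hsym hAlow
    (fun x => by rw [one_mul]; exact hAup x) p hp z
  have h1 := hG.energy_le hH hz hmem
  rw [sub_sub_cancel] at h1
  refine h1.trans (le_of_sq_le_sq ?_ (mul_nonneg (by positivity) (energy_nonneg _ _)))
  rw [mul_pow, hH.energy_sq, hH.energy_sq]
  exact key

/-- After `n ≥ √κ log (2 L / (β λ))` iterations the residual is below the tolerance. -/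
lemma IsGalerkin.norm_residual_le [FiniteDimensional ℝ E] {P : E →L[ℝ] E} (hH : IsSPD H)
    (hP : IsSPD P) {κ lam L b : ℝ} (hκ : 1 ≤ κ) (hlam : 0 < lam) (hL : lam ≤ L) (hb : 0 < b)
    (hlow : ∀ u, lam * ‖u‖ ^ 2 ≤ inner ℝ u (H u)) (hup : ∀ u, inner ℝ u (H u) ≤ L * ‖u‖ ^ 2)
    (hPlow : ∀ x, inner ℝ x (H x) ≤ inner ℝ x (P x))
    (hPup : ∀ x, inner ℝ x (P x) ≤ κ * inner ℝ x (H x))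
    (hG : IsGalerkin H P.inverse g n v r K) (hn : √κ * Real.log (2 * L / (b * lam)) ≤ n) :
    ‖r‖ ≤ b * √(lam / L) * ‖g‖ := by
  have hL0 : 0 < L := hlam.trans_le hL
  set z := H.inverse g
  have hz : H z = g := hH.isInvertible.self_apply_inverse g
  have h1 := hG.energy_le_exp hH hP hκ hPlow hPup hz
  have hs : 0 < √κ := Real.sqrt_pos.2 (by linarith)
  have h2 : 2 * Real.exp (-(n / √κ)) ≤ b * lam / L := by
    have : Real.exp (-(n / √κ)) ≤ (2 * L / (b * lam))⁻¹ := by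
      rw [← Real.exp_log (show 0 < 2 * L / (b * lam) by positivity), ← Real.exp_neg]
      apply Real.exp_le_exp.2
      apply neg_le_neg
      rw [le_div_iff₀ hs]; linarith
    calc _ ≤ 2 * (2 * L / (b * lam))⁻¹ := by gcongr
      _ = b * lam / L := by field_simp
  have h3 : energy H (z - v) ≤ b * lam / L * energy H z :=
    h1.trans (mul_le_mul_of_nonneg_right h2 (energy_nonneg _ _))
  have hr : r = H (z - v) := by rw [map_sub, hz, hG.residual]
  have h4 := hH.norm_apply_sq_le hL0 hup (z - v)
  have h5 := hH.mul_energy_sq_le hlam hlow z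
  rw [← hr] at h4
  rw [hz] at h5
  refine le_of_sq_le_sq ?_ (by positivity)
  rw [mul_pow, mul_pow, Real.sq_sqrt (by positivity)]
  -- Passing between Euclidean and energy norms costs `√(L/λ)`, which is why the energy error was
  -- made as small as `b λ/L`.
  calc ‖r‖ ^ 2 ≤ L * energy H (z - v) ^ 2 := h4
    _ ≤ L * (b * lam / L * energy H z) ^ 2 := by
        gcongr; exact energy_nonneg _ _
    _ = b ^ 2 * (lam / L) * (lam * energy H z ^ 2) := by field_simp
    _ ≤ b ^ 2 * (lam / L) * ‖g‖ ^ 2 := by gcongr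

end ConjugateGradient

/-! ### Calculus on an interval -/

/-- A function with nonnegative second derivative lies above its tangent. -/
lemma add_le_of_second_deriv_nonneg {x x' x'' : ℝ → ℝ}
    (h1 : ∀ t ∈ Set.Icc (0 : ℝ) 1, HasDerivAt x (x' t) t)
    (h2 : ∀ t ∈ Set.Icc (0 : ℝ) 1, HasDerivAt x' (x'' t) t)
    (h3 : ∀ t ∈ Set.Icc (0 : ℝ) 1, 0 ≤ x'' t) : x 0 + x' 0 ≤ x 1 := by
  obtain ⟨c, hc, hc'⟩ := exists_hasDerivAt_eq_slope x x' zero_lt_one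
    (fun t ht => (h1 t ht).continuousAt.continuousWithinAt)
    (fun t ht => h1 t ⟨ht.1.le, ht.2.le⟩)
  obtain ⟨e, he, he'⟩ := exists_hasDerivAt_eq_slope x' x'' hc.1
    (fun t ht => (h2 t ⟨ht.1, ht.2.trans hc.2.le⟩).continuousAt.continuousWithinAt)
    (fun t ht => h2 t ⟨ht.1.le, ht.2.le.trans hc.2.le⟩)
  have h4 := h3 e ⟨he.1.le, he.2.le.trans hc.2.le⟩
  rw [he', sub_zero, le_div_iff₀ hc.1] at h4
  rw [sub_zero, div_one] at hc'
  linarith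

/-- Both `c t²/2 - x` and `c t²/2 + x` have nonnegative second derivative. -/
lemma abs_sub_sub_le_of_abs_second_deriv_le {x x' x'' : ℝ → ℝ} {c : ℝ}
    (h1 : ∀ t ∈ Set.Icc (0 : ℝ) 1, HasDerivAt x (x' t) t)
    (h2 : ∀ t ∈ Set.Icc (0 : ℝ) 1, HasDerivAt x' (x'' t) t)
    (h3 : ∀ t ∈ Set.Icc (0 : ℝ) 1, |x'' t| ≤ c) : |x 1 - x 0 - x' 0| ≤ c / 2 := by
  have hsq : ∀ t : ℝ, HasDerivAt (fun t => c / 2 * t ^ 2) (c * t) t := fun t => by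
    refine ((hasDerivAt_pow 2 t).const_mul (c / 2)).congr_deriv ?_
    push_cast; ring
  have hlin : ∀ t : ℝ, HasDerivAt (fun t => c * t) c t := fun t => by
    simpa using (hasDerivAt_id t).const_mul c
  have hA := add_le_of_second_deriv_nonneg
    (x := fun t => c / 2 * t ^ 2 - x t) (x' := fun t => c * t - x' t) (x'' := fun t => c - x'' t)
    (fun t ht => (hsq t).sub (h1 t ht)) (fun t ht => (hlin t).sub (h2 t ht))
    (fun t ht => by linarith [(abs_le.1 (h3 t ht)).2])
  have hB := add_le_of_second_deriv_nonneg
    (x := fun t => c / 2 * t ^ 2 + x t) (x' := fun t => c * t + x' t) (x'' := fun t => c + x'' t)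
    (fun t ht => (hsq t).add (h1 t ht)) (fun t ht => (hlin t).add (h2 t ht))
    (fun t ht => by linarith [(abs_le.1 (h3 t ht)).1])
  norm_num at hA hB
  rw [abs_le]
  constructor <;> linarith

/-- Grönwall: `exp(-ct) q(t)` is nonincreasing. -/
lemma le_exp_mul_of_deriv_le {q q' : ℝ → ℝ} {c : ℝ}
    (h1 : ∀ t ∈ Set.Icc (0 : ℝ) 1, HasDerivAt q (q' t) t)
    (h2 : ∀ t ∈ Set.Icc (0 : ℝ) 1, q' t ≤ c * q t) {t : ℝ} (ht : t ∈ Set.Icc (0 : ℝ) 1) :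
    q t ≤ Real.exp (c * t) * q 0 := by
  have hd : ∀ t ∈ Set.Icc (0 : ℝ) 1, HasDerivAt (fun t => Real.exp (-(c * t)) * q t)
      (Real.exp (-(c * t)) * (q' t - c * q t)) t := fun t ht => by
    have h3 : HasDerivAt (fun t : ℝ => -(c * t)) (-(c * 1)) t :=
      ((hasDerivAt_id t).const_mul c).neg
    refine (h3.exp.mul (h1 t ht)).congr_deriv ?_
    ring
  have hanti : AntitoneOn (fun t => Real.exp (-(c * t)) * q t) (Set.Icc 0 1) := by
    refine antitoneOn_of_deriv_nonpos (convex_Icc 0 1)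
      (fun t ht => (hd t ht).continuousAt.continuousWithinAt)
      (fun t ht => (hd t (interior_subset ht)).differentiableAt.differentiableWithinAt) ?_
    intro t ht
    rw [(hd t (interior_subset ht)).deriv]
    exact mul_nonpos_of_nonneg_of_nonpos (Real.exp_pos _).le
      (by linarith [h2 t (interior_subset ht)])
  have h3 := hanti (Set.left_mem_Icc.2 zero_le_one) ht ht.1
  simp only [mul_zero, neg_zero, Real.exp_zero, one_mul] at h3
  rw [Real.exp_neg, inv_mul_le_iff₀ (Real.exp_pos _)] at h3
  exact h3

/-! ### Symmetric trilinear forms -/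

/-- Polarization of a bound on the diagonal of a symmetric trilinear form. -/
lemma abs_inner_apply_apply_le {E : Type*} [NormedAddCommGroup E] [InnerProductSpace ℝ E]
    {H : E →L[ℝ] E} (hH : IsSPD H) (D : E →L[ℝ] E →L[ℝ] E)
    (h1 : ∀ u x y, inner ℝ x (D u y) = inner ℝ y (D u x)) (h2 : ∀ u y, D u y = D y u)
    (hb : ∀ u, |inner ℝ u (D u u)| ≤ 2 * energy H u ^ 3) (u v : E) :
    |inner ℝ u (D v v)| ≤ 3 * energy H u * energy H v ^ 2 := by
  have unit : ∀ u v : E, energy H u = 1 → energy H v = 1 → |inner ℝ u (D v v)| ≤ 3 := by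
    intro u v hu hv
    -- The odd part in `u` of the cubic form at `2v ± u`. With `‖2v ± u‖ ≤ 3` and the sum of the two
    -- squared norms equal to `10`, it yields `64/24 < 3`; the same estimate with `v ± u` would only
    -- give `20/6`.
    have hid : 24 * inner ℝ u (D v v) =
        inner ℝ ((2 : ℝ) • v + u) (D ((2 : ℝ) • v + u) ((2 : ℝ) • v + u))
        - inner ℝ ((2 : ℝ) • v - u) (D ((2 : ℝ) • v - u) ((2 : ℝ) • v - u))
        - 2 * inner ℝ u (D u u) := by
      simp only [map_add, map_sub, map_smul, add_apply,
        sub_apply, smul_apply, inner_add_left,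
        inner_add_right, inner_sub_left, inner_sub_right, inner_smul_left, inner_smul_right,
        conj_trivial]
      have e1 : inner ℝ v (D v u) = inner ℝ u (D v v) := h1 v v u
      have e2 : inner ℝ v (D u v) = inner ℝ u (D v v) := by rw [h2 u v, e1]
      have e3 : inner ℝ u (D u v) = inner ℝ v (D u u) := h1 u u v
      have e4 : inner ℝ u (D v u) = inner ℝ v (D u u) := by rw [h2 v u, e3]
      rw [e1, e2, e3, e4]
      ring
    have hsmul : energy H ((2 : ℝ) • v) = 2 := by rw [energy_smul, hv]; norm_num
    have hp := hH.energy_add_le ((2 : ℝ) • v) u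
    have hm := hH.energy_add_le ((2 : ℝ) • v) (-u)
    rw [energy_neg, ← sub_eq_add_neg] at hm
    have hp2 := hH.energy_sq_add ((2 : ℝ) • v) u
    have hm2 := hH.energy_sq_sub ((2 : ℝ) • v) u
    rw [hsmul, hu] at hp hm hp2 hm2
    have c1 := abs_le.1 (hb ((2 : ℝ) • v + u))
    have c2 := abs_le.1 (hb ((2 : ℝ) • v - u))
    have c3 := abs_le.1 (hb u)
    rw [hu] at c3
    have d1 : energy H ((2 : ℝ) • v + u) ^ 3 ≤ 3 * energy H ((2 : ℝ) • v + u) ^ 2 := by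
      nlinarith [sq_nonneg (energy H ((2 : ℝ) • v + u))]
    have d2 : energy H ((2 : ℝ) • v - u) ^ 3 ≤ 3 * energy H ((2 : ℝ) • v - u) ^ 2 := by
      nlinarith [sq_nonneg (energy H ((2 : ℝ) • v - u))]
    rw [abs_le]
    constructor <;> linarith [c1.1, c1.2, c2.1, c2.2, c3.1, c3.2]
  rcases eq_or_ne u 0 with rfl | hu
  · simp [energy]
  rcases eq_or_ne v 0 with rfl | hv
  · simp [energy]
  have hu' := hH.energy_pos hu
  have hv' := hH.energy_pos hv
  have h := unit ((energy H u)⁻¹ • u) ((energy H v)⁻¹ • v)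
    (by rw [energy_smul, abs_of_pos (inv_pos.2 hu'), inv_mul_cancel₀ hu'.ne'])
    (by rw [energy_smul, abs_of_pos (inv_pos.2 hv'), inv_mul_cancel₀ hv'.ne'])
  simp only [map_smul, smul_apply, inner_smul_left, inner_smul_right,
    conj_trivial, abs_mul, abs_inv, abs_of_pos hu', abs_of_pos hv'] at h
  field_simp at h
  linarith

/-! ### Gradients and Hessians -/

section Derivatives

variable {d : ℕ} {f : Vec d → ℝ}

lemma hasDerivAt_line (w p : Vec d) (t : ℝ) : HasDerivAt (fun t : ℝ => w + t • p) p t := by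
  simpa using ((hasDerivAt_id t).smul_const p).const_add w

lemma hasDerivAt_comp_line (hf : TwiceDifferentiable f) (w p : Vec d) (t : ℝ) :
    HasDerivAt (fun t : ℝ => f (w + t • p)) (inner ℝ p (gradient f (w + t • p))) t := by
  have h := (hf.differentiable (w + t • p)).hasFDerivAt.comp_hasDerivAt t (hasDerivAt_line w p t)
  rwa [← inner_gradient_left, real_inner_comm] at h

lemma hasDerivAt_inner_gradient (hf : TwiceDifferentiable f) (w p h : Vec d) (t : ℝ) :
    HasDerivAt (fun t : ℝ => inner ℝ h (gradient f (w + t • p)))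
      (inner ℝ h (hess f (w + t • p) p)) t := by
  have h1 := (hf.differentiable_gradient (w + t • p)).hasFDerivAt.comp_hasDerivAt t
    (hasDerivAt_line w p t)
  exact (innerSL ℝ h).hasFDerivAt.comp_hasDerivAt t h1

lemma TwiceDifferentiable.differentiableAt_fderiv (hf : TwiceDifferentiable f) (w : Vec d) :
    DifferentiableAt ℝ (fderiv ℝ f) w := by
  rw [← toDual_comp_gradient]
  exact ((InnerProductSpace.toDual ℝ (Vec d)).toContinuousLinearEquiv.differentiable
    (gradient f w)).comp w (hf.differentiable_gradient w)

lemma TwiceDifferentiable.inner_hess (hf : TwiceDifferentiable f) (w x y : Vec d) :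
    inner ℝ x (hess f w y) = fderiv ℝ (fderiv ℝ f) w y x := by
  have h1 : HasFDerivAt (fun z => inner ℝ x (gradient f z)) (innerSL ℝ x ∘L hess f w) w :=
    (innerSL ℝ x).hasFDerivAt.comp w (hf.differentiable_gradient w).hasFDerivAt
  have h2 : HasFDerivAt (fun z => fderiv ℝ f z x)
      (ContinuousLinearMap.apply ℝ ℝ x ∘L fderiv ℝ (fderiv ℝ f) w) w :=
    (ContinuousLinearMap.apply ℝ ℝ x).hasFDerivAt.comp w
      (hf.differentiableAt_fderiv w).hasFDerivAt
  have h3 : (fun z => inner ℝ x (gradient f z)) = fun z => fderiv ℝ f z x := by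
    funext z
    rw [real_inner_comm, inner_gradient_left]
  rw [h3] at h1
  exact DFunLike.congr_fun (h1.unique h2) y

/-- Symmetry needs no continuity of the second derivative, so it holds for the individual `f i`. -/
lemma TwiceDifferentiable.hess_symm (hf : TwiceDifferentiable f) (w x y : Vec d) :
    inner ℝ x (hess f w y) = inner ℝ y (hess f w x) := by
  rw [hf.inner_hess, hf.inner_hess]
  exact second_derivative_symmetric (fun z => (hf.differentiable z).hasFDerivAt)
    (hf.differentiableAt_fderiv w).hasFDerivAt y x

lemma contDiff_gradient {n : ℕ} (hf : ContDiff ℝ (n + 1 : ℕ) f) : ContDiff ℝ n (gradient f) :=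
  (InnerProductSpace.toDual ℝ (Vec d)).symm.toContinuousLinearEquiv.contDiff.comp
    (hf.fderiv_right (by norm_cast))

lemma contDiff_hess (hf : ContDiff ℝ 3 f) : ContDiff ℝ 1 (hess f) :=
  (contDiff_gradient (n := 2) hf).fderiv_right (by norm_num)

lemma twiceDifferentiable_of_contDiff (hf : ContDiff ℝ 3 f) : TwiceDifferentiable f where
  differentiable := hf.differentiable (by norm_num)
  differentiable_gradient := (contDiff_gradient (n := 2) hf).differentiable (by norm_num)

lemma HessianBounds.isSPD {lam L : ℝ} (hb : HessianBounds f lam L) (hf : ContDiff ℝ 3 f)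
    (w : Vec d) : IsSPD (hess f w) where
  symm := (twiceDifferentiable_of_contDiff hf).hess_symm w
  pos := fun x hx => lt_of_lt_of_le (by have := hb.pos; have := norm_pos_iff.2 hx; positivity)
    (hb.lower w x)

lemma hasDerivAt_inner_hess (hf : ContDiff ℝ 3 f) (w p h k : Vec d) (t : ℝ) :
    HasDerivAt (fun t : ℝ => inner ℝ h (hess f (w + t • p) k))
      (inner ℝ h (fderiv ℝ (hess f) (w + t • p) p k)) t := by
  have h1 := ((contDiff_hess hf).differentiable (by norm_num)
    (w + t • p)).hasFDerivAt.comp_hasDerivAt t (hasDerivAt_line w p t)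
  have h2 := h1.clm_apply (hasDerivAt_const t k)
  refine ((innerSL ℝ h).hasFDerivAt.comp_hasDerivAt t h2).congr_deriv ?_
  simp

/-- Differentiating the symmetry of the Hessian. Together with `fderiv_hess_comm` it makes `f'''(w)`
a symmetric trilinear form, as polarization requires. -/
lemma fderiv_hess_symm (hf : ContDiff ℝ 3 f) (w u x y : Vec d) :
    inner ℝ x (fderiv ℝ (hess f) w u y) = inner ℝ y (fderiv ℝ (hess f) w u x) := by
  have h1 := hasDerivAt_inner_hess hf w u x y 0
  have h2 := hasDerivAt_inner_hess hf w u y x 0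
  simp only [(twiceDifferentiable_of_contDiff hf).hess_symm _ x y] at h1
  have := h1.unique h2
  simpa using this

lemma fderiv_hess_comm (hf : ContDiff ℝ 3 f) (w u y : Vec d) :
    fderiv ℝ (hess f) w u y = fderiv ℝ (hess f) w y u :=
  ((contDiff_gradient (n := 2) hf).contDiffAt (x := w)).isSymmSndFDerivAt (by simp) u y

lemma IsStandardSelfConcordant.abs_le {f : Vec d → ℝ} (hf : IsStandardSelfConcordant f)
    {lam L : ℝ} (hb : HessianBounds f lam L) (w u : Vec d) :
    |inner ℝ u (fderiv ℝ (hess f) w u u)| ≤ 2 * energy (hess f w) u ^ 3 := by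
  have h := hf.bound w u
  rw [((contDiff_hess hf.contDiff).differentiable (by norm_num) w).lineDeriv_eq_fderiv] at h
  refine h.trans_eq ?_
  have hnn := (hb.isSPD hf.contDiff w).nonneg u
  congr 1
  rw [energy, Real.sqrt_eq_rpow, ← Real.rpow_natCast, ← Real.rpow_mul hnn]
  norm_num

end Derivatives
/-! ### Self-concordant functions -/

/-- The Newton decrement `√⟨f'(w), f''(w)⁻¹ f'(w)⟩`. -/
noncomputable def newtonDecrement {d : ℕ} (f : Vec d → ℝ) (w : Vec d) : ℝ :=
  energy (hess f w) ((hess f w).inverse (gradient f w))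

section SelfConcordant

variable {d : ℕ} {f : Vec d → ℝ} {lam L : ℝ}

lemma newtonDecrement_nonneg (f : Vec d → ℝ) (w : Vec d) : 0 ≤ newtonDecrement f w :=
  energy_nonneg _ _

/-- The inverse local norm of a fixed direction is `1`-Lipschitz along this direction. -/
lemma abs_inv_energy_sub_le (hf : IsStandardSelfConcordant f) (hb : HessianBounds f lam L)
    (w : Vec d) {p : Vec d} (hp : p ≠ 0) {t : ℝ} (ht : 0 ≤ t) :
    |(energy (hess f (w + t • p)) p)⁻¹ - (energy (hess f w) p)⁻¹| ≤ t := by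
  -- The derivative is `-f'''[p,p,p] / (2‖p‖³)` in the local norm, and self-concordance says
  -- precisely that its modulus is at most `1`.
  have hd : ∀ t : ℝ, HasDerivAt (fun t : ℝ => (energy (hess f (w + t • p)) p)⁻¹)
      (-(inner ℝ p (fderiv ℝ (hess f) (w + t • p) p p) / (2 * energy (hess f (w + t • p)) p))
        / energy (hess f (w + t • p)) p ^ 2) t := fun t =>
    ((hasDerivAt_inner_hess hf.contDiff w p p p t).sqrt
      ((hb.isSPD hf.contDiff _).pos p hp).ne').inv
      ((hb.isSPD hf.contDiff _).energy_pos hp).ne'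
  have h := convex_univ.norm_image_sub_le_of_norm_hasDerivWithin_le (C := 1) (x := 0) (y := t)
    (fun x _ => (hd x).hasDerivWithinAt) (fun x _ => ?_) (Set.mem_univ _) (Set.mem_univ _)
  · simpa [abs_of_nonneg ht] using h
  · have he := (hb.isSPD hf.contDiff (w + x • p)).energy_pos hp
    have h3 := hf.abs_le hb (w + x • p) p
    rw [Real.norm_eq_abs, abs_div, abs_neg, abs_div, abs_of_pos (pow_pos he 2),
      abs_of_pos (mul_pos two_pos he), div_div, div_le_one (by positivity)]
    linarith

lemma energy_line_le (hf : IsStandardSelfConcordant f) (hb : HessianBounds f lam L)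
    (w p : Vec d) {t : ℝ} (ht : 0 ≤ t) (hta : t * energy (hess f w) p < 1) :
    energy (hess f (w + t • p)) p ≤ energy (hess f w) p / (1 - t * energy (hess f w) p) := by
  rcases eq_or_ne p 0 with rfl | hp
  · simp [energy]
  have ha := (hb.isSPD hf.contDiff w).energy_pos hp
  have he := (hb.isSPD hf.contDiff (w + t • p)).energy_pos hp
  have h := (abs_le.1 (abs_inv_energy_sub_le hf hb w hp ht)).1
  set a := energy (hess f w) p
  set e := energy (hess f (w + t • p)) p
  rw [le_div_iff₀ (by linarith)]
  have h2 : (e⁻¹ - a⁻¹) * (e * a) = a - e := by field_simp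
  nlinarith [mul_le_mul_of_nonneg_right h (mul_pos he ha).le]

lemma le_energy_line (hf : IsStandardSelfConcordant f) (hb : HessianBounds f lam L)
    (w p : Vec d) {t : ℝ} (ht : 0 ≤ t) :
    energy (hess f w) p / (1 + t * energy (hess f w) p) ≤ energy (hess f (w + t • p)) p := by
  rcases eq_or_ne p 0 with rfl | hp
  · simp [energy]
  have ha := (hb.isSPD hf.contDiff w).energy_pos hp
  have he := (hb.isSPD hf.contDiff (w + t • p)).energy_pos hp
  have h := (abs_le.1 (abs_inv_energy_sub_le hf hb w hp ht)).2
  set a := energy (hess f w) p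
  set e := energy (hess f (w + t • p)) p
  rw [div_le_iff₀ (by positivity)]
  have h2 : (e⁻¹ - a⁻¹) * (e * a) = a - e := by field_simp
  nlinarith [mul_le_mul_of_nonneg_right h (mul_pos he ha).le]

/-- The standard upper bound `f(w + p) ≤ f(w) + ⟨f'(w), p⟩ + ω_*(‖p‖_w)`. -/
lemma apply_add_le (hf : IsStandardSelfConcordant f) (hb : HessianBounds f lam L)
    (w p : Vec d) {a : ℝ} (ha : energy (hess f w) p = a) (ha1 : a < 1) :
    f (w + p) ≤ f w + inner ℝ p (gradient f w) + (-a - Real.log (1 - a)) := by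
  have ha0 : 0 ≤ a := ha ▸ energy_nonneg _ _
  have htd := twiceDifferentiable_of_contDiff hf.contDiff
  have hpos : ∀ t ∈ Set.Icc (0 : ℝ) 1, 0 < 1 - t * a := fun t ht => by
    nlinarith [ht.1, ht.2, mul_le_mul_of_nonneg_right ht.2 ha0]
  have hlin : ∀ t : ℝ, HasDerivAt (fun t : ℝ => 1 - t * a) (-a) t := fun t =>
    (((hasDerivAt_id t).mul_const a).const_sub 1).congr_deriv (by simp)
  -- The comparison function `-ta - log(1 - ta)` has second derivative `a²/(1 - ta)²`, which
  -- dominates that of `f` along the segment by `energy_line_le`.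
  have h := add_le_of_second_deriv_nonneg
    (x := fun t => (-(t * a) - Real.log (1 - t * a)) - f (w + t • p))
    (x' := fun t => (-a + a * (1 - t * a)⁻¹) - inner ℝ p (gradient f (w + t • p)))
    (x'' := fun t => a * (a / (1 - t * a) ^ 2) - inner ℝ p (hess f (w + t • p) p))
    (fun t ht => by
      refine HasDerivAt.sub (((((hasDerivAt_id t).mul_const a).neg).sub
        ((hlin t).log (hpos t ht).ne')).congr_deriv ?_) (hasDerivAt_comp_line htd w p t)
      simp only [div_eq_mul_inv]; ring)
    (fun t ht => by
      refine HasDerivAt.sub (((((hlin t).inv (hpos t ht).ne').const_mul a).const_add _).congr_deriv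
        ?_) (hasDerivAt_inner_gradient htd w p p t)
      rw [neg_neg])
    (fun t ht => by
      have h1 := energy_line_le hf hb w p ht.1 (by rw [ha]; linarith [hpos t ht])
      rw [ha] at h1
      rw [← (hb.isSPD hf.contDiff _).energy_sq, sub_nonneg]
      calc energy (hess f (w + t • p)) p ^ 2 ≤ (a / (1 - t * a)) ^ 2 :=
            pow_le_pow_left₀ (energy_nonneg _ _) h1 2
        _ = a * (a / (1 - t * a) ^ 2) := by rw [div_pow]; ring)
  simp only [zero_smul, zero_mul, one_smul, one_mul, add_zero, sub_zero, Real.log_one, inv_one,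
    mul_one, neg_zero] at h
  linarith

/-- The standard lower bound `f(w + p) ≥ f(w) + ⟨f'(w), p⟩ + ω(‖p‖_w)`. -/
lemma le_apply_add (hf : IsStandardSelfConcordant f) (hb : HessianBounds f lam L)
    (w p : Vec d) {a : ℝ} (ha : energy (hess f w) p = a) :
    f w + inner ℝ p (gradient f w) + (a - Real.log (1 + a)) ≤ f (w + p) := by
  have ha0 : 0 ≤ a := ha ▸ energy_nonneg _ _
  have htd := twiceDifferentiable_of_contDiff hf.contDiff
  have hpos : ∀ t ∈ Set.Icc (0 : ℝ) 1, 0 < 1 + t * a := fun t ht => by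
    have := mul_nonneg ht.1 ha0
    linarith
  have hlin : ∀ t : ℝ, HasDerivAt (fun t : ℝ => 1 + t * a) a t := fun t =>
    (((hasDerivAt_id t).mul_const a).const_add 1).congr_deriv (by simp)
  have h := add_le_of_second_deriv_nonneg
    (x := fun t => f (w + t • p) - (t * a - Real.log (1 + t * a)))
    (x' := fun t => inner ℝ p (gradient f (w + t • p)) - (a - a * (1 + t * a)⁻¹))
    (x'' := fun t => inner ℝ p (hess f (w + t • p) p) - a * (a / (1 + t * a) ^ 2))
    (fun t ht => by
      refine HasDerivAt.sub (hasDerivAt_comp_line htd w p t) ((((hasDerivAt_id t).mul_const a).sub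
        ((hlin t).log (hpos t ht).ne')).congr_deriv ?_)
      simp only [div_eq_mul_inv]; ring)
    (fun t ht => by
      refine HasDerivAt.sub (hasDerivAt_inner_gradient htd w p p t)
        (((((hlin t).inv (hpos t ht).ne').const_mul a).const_sub _).congr_deriv ?_)
      ring)
    (fun t ht => by
      have h1 := le_energy_line hf hb w p ht.1
      rw [ha] at h1
      rw [← (hb.isSPD hf.contDiff _).energy_sq, sub_nonneg]
      calc a * (a / (1 + t * a) ^ 2) = (a / (1 + t * a)) ^ 2 := by rw [div_pow]; ring
        _ ≤ energy (hess f (w + t • p)) p ^ 2 :=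
            pow_le_pow_left₀ (div_nonneg ha0 (hpos t ht).le) h1 2)
  simp only [zero_smul, zero_mul, one_smul, one_mul, add_zero, sub_zero, Real.log_one, inv_one,
    mul_one, sub_self] at h
  linarith

/-- `f(w) - f(y) ≤ ω_*(η)` where `η < 1` is the Newton decrement at `w`. -/
lemma apply_sub_le (hf : IsStandardSelfConcordant f) (hb : HessianBounds f lam L)
    (w y : Vec d) (hw : newtonDecrement f w < 1) :
    f w - f y ≤ -newtonDecrement f w - Real.log (1 - newtonDecrement f w) := by
  have h := le_apply_add hf hb w (y - w) rfl
  rw [add_sub_cancel] at h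
  have hH := hb.isSPD hf.contDiff w
  have h1 := hH.abs_inner_le (y - w) ((hess f w).inverse (gradient f w))
  rw [hH.isInvertible.self_apply_inverse] at h1
  change _ ≤ energy (hess f w) (y - w) * newtonDecrement f w at h1
  have ha := energy_nonneg (hess f w) (y - w)
  set a := energy (hess f w) (y - w)
  set e := newtonDecrement f w
  -- Conjugacy of `ω` and `ω_*`: the logarithm of `(1+a)(1-e)` gives `ω(a) - a e ≥ e + log(1 - e)`.
  have h2 := Real.log_le_sub_one_of_pos
    (mul_pos (by linarith : 0 < 1 + a) (by linarith : 0 < 1 - e))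
  rw [Real.log_mul (by linarith) (by linarith)] at h2
  nlinarith [(abs_le.1 h1).1]

/-- A variant of `apply_add_le` for the derivative, in the dual local norm. -/
lemma abs_inner_gradient_sub_le (hf : IsStandardSelfConcordant f) (hb : HessianBounds f lam L)
    (w p h : Vec d) {a : ℝ} (ha : energy (hess f w) p = a) (ha1 : a ≤ 1 / 7) :
    energy (hess f w) h ≤ 9 / 7 * energy (hess f (w + p)) h ∧
    |inner ℝ h (gradient f (w + p)) - inner ℝ h (gradient f w) - inner ℝ h (hess f w p)|
      ≤ 21 / 8 * a ^ 2 * energy (hess f w) h := by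
  have ha0 : 0 ≤ a := ha ▸ energy_nonneg _ _
  have htd := twiceDifferentiable_of_contDiff hf.contDiff
  have hexp : Real.exp (1 / 2) ≤ (9 / 7) ^ 2 := by
    rw [← Real.le_log_iff_exp_le (by norm_num), Real.log_pow]
    have := Real.le_log_one_add_of_nonneg (show (0 : ℝ) ≤ 2 / 7 by norm_num)
    norm_num at this ⊢
    linarith
  have hp : ∀ t ∈ Set.Icc (0 : ℝ) 1, energy (hess f (w + t • p)) p ≤ 7 / 6 * a := fun t ht => by
    have h0 : t * a ≤ 1 / 7 := by nlinarith [ht.1, ht.2]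
    have h1 := energy_line_le hf hb w p ht.1 (by rw [ha]; linarith)
    rw [ha] at h1
    refine h1.trans ?_
    rw [div_le_iff₀ (by linarith)]
    nlinarith
  have hcubic : ∀ (t : ℝ) (u v : Vec d), |inner ℝ u (fderiv ℝ (hess f) (w + t • p) v v)| ≤
      3 * energy (hess f (w + t • p)) u * energy (hess f (w + t • p)) v ^ 2 := fun t u v =>
    abs_inner_apply_apply_le (hb.isSPD hf.contDiff _) _
      (fun x y z => fderiv_hess_symm hf.contDiff _ x y z)
      (fun x y => fderiv_hess_comm hf.contDiff _ x y) (fun x => hf.abs_le hb _ x) u v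
  -- The factor is `3 · (7/6) · (1/7) = 1/2`. Grönwall then changes squared local norms by at most
  -- `exp(1/2) ≤ (9/7)²`.
  have hq : ∀ t ∈ Set.Icc (0 : ℝ) 1, |inner ℝ h (fderiv ℝ (hess f) (w + t • p) p h)| ≤
      1 / 2 * inner ℝ h (hess f (w + t • p) h) := fun t ht => by
    rw [fderiv_hess_comm hf.contDiff, fderiv_hess_symm hf.contDiff]
    refine (hcubic t p h).trans ?_
    rw [← (hb.isSPD hf.contDiff _).energy_sq]
    refine mul_le_mul_of_nonneg_right ?_ (sq_nonneg _)
    linarith [hp t ht]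
  have hup : ∀ t ∈ Set.Icc (0 : ℝ) 1,
      energy (hess f (w + t • p)) h ≤ 9 / 7 * energy (hess f w) h := fun t ht => by
    have h1 := le_exp_mul_of_deriv_le (c := 1 / 2)
      (fun t _ => hasDerivAt_inner_hess hf.contDiff w p h h t)
      (fun t ht => (le_abs_self _).trans (hq t ht)) ht
    refine le_of_sq_le_sq ?_ (mul_nonneg (by norm_num) (energy_nonneg _ _))
    rw [mul_pow, (hb.isSPD hf.contDiff _).energy_sq, (hb.isSPD hf.contDiff _).energy_sq]
    simp only [zero_smul, add_zero] at h1
    refine h1.trans (mul_le_mul_of_nonneg_right (le_trans ?_ hexp)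
      ((hb.isSPD hf.contDiff _).nonneg _))
    exact Real.exp_le_exp.2 (by linarith [ht.2])
  constructor
  · have h1 := le_exp_mul_of_deriv_le (c := -(1 / 2))
      (fun t _ => (hasDerivAt_inner_hess hf.contDiff w p h h t).neg)
      (fun t ht => by simp only [Pi.neg_apply]; linarith [(abs_le.1 (hq t ht)).1])
      (Set.right_mem_Icc.2 zero_le_one)
    simp only [Pi.neg_apply, zero_smul, one_smul, add_zero, mul_one, mul_neg, neg_le_neg_iff,
      Real.exp_neg] at h1
    rw [inv_mul_le_iff₀ (Real.exp_pos _)] at h1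
    refine le_of_sq_le_sq ?_ (mul_nonneg (by norm_num) (energy_nonneg _ _))
    rw [mul_pow, (hb.isSPD hf.contDiff _).energy_sq, (hb.isSPD hf.contDiff _).energy_sq]
    exact h1.trans (mul_le_mul_of_nonneg_right hexp ((hb.isSPD hf.contDiff _).nonneg _))
  · have h1 := abs_sub_sub_le_of_abs_second_deriv_le (c := 21 / 4 * a ^ 2 * energy (hess f w) h)
      (fun t _ => hasDerivAt_inner_gradient htd w p h t)
      (fun t _ => hasDerivAt_inner_hess hf.contDiff w p h p t)
      (fun t ht => ?_)
    · simp only [zero_smul, one_smul, add_zero] at h1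
      exact h1.trans_eq (by ring)
    · refine (hcubic t h p).trans ?_
      have h2 := pow_le_pow_left₀ (energy_nonneg _ _) (hp t ht) 2
      calc 3 * energy (hess f (w + t • p)) h * energy (hess f (w + t • p)) p ^ 2
          ≤ 3 * (9 / 7 * energy (hess f w) h) * (7 / 6 * a) ^ 2 := by
            gcongr
            · have := energy_nonneg (hess f w) h; positivity
            · exact hup t ht
        _ = 21 / 4 * a ^ 2 * energy (hess f w) h := by ring

end SelfConcordant

/-! ### The inexact damped Newton step -/

section DampedNewton

variable {d : ℕ}

/-- `v` is an approximate Newton direction at `w`: a Galerkin solution of `f''(w) v = f'(w)` with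
a small residual. -/
structure IsApproxNewton (f : Vec d → ℝ) (lam L : ℝ) (w v : Vec d) : Prop where
  norm_le : ‖gradient f w - hess f w v‖ ≤ beta * √(lam / L) * ‖gradient f w‖
  orth : inner ℝ (gradient f w - hess f w v) v = 0

/-- The damped Newton step in direction `-v`. -/
noncomputable def dampedStep (f : Vec d → ℝ) (w v : Vec d) : Vec d :=
  w - (1 / (1 + energy (hess f w) v)) • v

variable {f : Vec d → ℝ} {lam L : ℝ} {w v : Vec d}

lemma IsApproxNewton.inner_gradient (hv : IsApproxNewton f lam L w v)
    (hH : IsSPD (hess f w)) : inner ℝ v (gradient f w) = energy (hess f w) v ^ 2 := by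
  have := hv.orth
  rw [inner_sub_left, real_inner_comm, real_inner_comm v (hess f w v)] at this
  rw [hH.energy_sq]
  linarith

lemma IsApproxNewton.energy_le (hv : IsApproxNewton f lam L w v) (hH : IsSPD (hess f w)) :
    energy (hess f w) v ≤ newtonDecrement f w := by
  have h := hH.inner_le v ((hess f w).inverse (gradient f w))
  rw [hH.isInvertible.self_apply_inverse, hv.inner_gradient hH] at h
  change _ ≤ _ * newtonDecrement f w at h
  have := newtonDecrement_nonneg f w
  have := energy_nonneg (hess f w) v
  by_contra! hlt
  nlinarith

/-- The residual is `H(z - v)`. Bounding it below costs `√λ`, bounding `‖f'(w)‖` above costs `√L`,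
and the factor `√(λ/L)` in the tolerance cancels both. -/
lemma IsApproxNewton.energy_inverse_le (hv : IsApproxNewton f lam L w v)
    (hb : HessianBounds f lam L) (hf : ContDiff ℝ 3 f) :
    energy (hess f w) ((hess f w).inverse (gradient f w) - v) ≤ beta * newtonDecrement f w := by
  have hH := hb.isSPD hf w
  have hlam := hb.pos
  have hL : 0 < L := hlam.trans_le hb.le
  have h1 := hH.mul_energy_sq_le hlam (hb.lower w) ((hess f w).inverse (gradient f w) - v)
  have h2 := hH.norm_apply_sq_le hL (hb.upper w) ((hess f w).inverse (gradient f w))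
  rw [map_sub, hH.isInvertible.self_apply_inverse] at h1
  rw [hH.isInvertible.self_apply_inverse] at h2
  change _ ≤ L * newtonDecrement f w ^ 2 at h2
  have h3 := pow_le_pow_left₀ (norm_nonneg _) hv.norm_le 2
  rw [mul_pow, mul_pow, Real.sq_sqrt (by positivity)] at h3
  have hbeta : 0 < beta := by norm_num [beta]
  refine le_of_sq_le_sq ?_ (mul_nonneg hbeta.le (newtonDecrement_nonneg _ _))
  have h4 : lam * energy (hess f w) ((hess f w).inverse (gradient f w) - v) ^ 2 ≤
      lam * (beta * newtonDecrement f w) ^ 2 := by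
    calc _ ≤ beta ^ 2 * (lam / L) * ‖gradient f w‖ ^ 2 := h1.trans h3
      _ ≤ beta ^ 2 * (lam / L) * (L * newtonDecrement f w ^ 2) := by gcongr
      _ = lam * (beta * newtonDecrement f w) ^ 2 := by field_simp
  exact le_of_mul_le_mul_left h4 hlam

lemma IsApproxNewton.le_energy (hv : IsApproxNewton f lam L w v)
    (hb : HessianBounds f lam L) (hf : ContDiff ℝ 3 f) :
    (1 - beta) * newtonDecrement f w ≤ energy (hess f w) v := by
  have h1 := hv.energy_inverse_le hb hf
  have h2 := (hb.isSPD hf w).energy_add_le ((hess f w).inverse (gradient f w) - v) v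
  rw [sub_add_cancel] at h2
  change newtonDecrement f w ≤ _ at h2
  linarith

lemma dampedStep_eq (f : Vec d → ℝ) (w v : Vec d) :
    dampedStep f w v = w + (-(1 / (1 + energy (hess f w) v))) • v := by
  rw [dampedStep, neg_smul, sub_eq_add_neg]

lemma energy_dampedStep (f : Vec d → ℝ) (w v : Vec d) :
    energy (hess f w) ((-(1 / (1 + energy (hess f w) v))) • v) =
      energy (hess f w) v / (1 + energy (hess f w) v) := by
  have := energy_nonneg (hess f w) v
  rw [energy_smul, abs_neg, abs_of_nonneg (by positivity)]
  ring

/-- The damped step decreases `f` by at least `ω(δ)`. -/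
lemma IsApproxNewton.apply_dampedStep_le (hv : IsApproxNewton f lam L w v)
    (hf : IsStandardSelfConcordant f) (hb : HessianBounds f lam L) :
    f (dampedStep f w v) ≤ f w - omega (energy (hess f w) v) := by
  have h0 := energy_nonneg (hess f w) v
  have h := apply_add_le hf hb w ((-(1 / (1 + energy (hess f w) v))) • v) (energy_dampedStep f w v)
    (by rw [div_lt_one (by linarith)]; linarith)
  rw [← dampedStep_eq, inner_smul_left, hv.inner_gradient (hb.isSPD hf.contDiff w)] at h
  set δ := energy (hess f w) v
  have h1 : 1 - δ / (1 + δ) = (1 + δ)⁻¹ := by field_simp; ring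
  rw [h1, Real.log_inv, conj_trivial] at h
  -- The step length `1/(1+δ)` turns the upper bound into exactly `-ω(δ)`.
  have h2 : -(1 / (1 + δ)) * δ ^ 2 + (-(δ / (1 + δ)) - -Real.log (1 + δ)) = -omega δ := by
    rw [omega]; field_simp; ring
  linarith

/-- Linear convergence of the Newton decrement. -/
lemma IsApproxNewton.newtonDecrement_dampedStep_le (hv : IsApproxNewton f lam L w v)
    (hf : IsStandardSelfConcordant f) (hb : HessianBounds f lam L)
    (hw : newtonDecrement f w ≤ 1 / 6) :
    newtonDecrement f (dampedStep f w v) ≤ 7 / 10 * newtonDecrement f w := by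
  have hH := hb.isSPD hf.contDiff w
  have hδη := hv.energy_le hH
  have hres := hv.energy_inverse_le hb hf.contDiff
  have hδ0 := energy_nonneg (hess f w) v
  set p := (-(1 / (1 + energy (hess f w) v))) • v with hp
  have hpa := energy_dampedStep f w v
  set w' := dampedStep f w v with hw'
  have hww : w' = w + p := dampedStep_eq f w v
  have hH' := hb.isSPD hf.contDiff w'
  -- Testing `f'(w')` against the exact Newton direction at `w'` produces the square of the new
  -- decrement.
  set h := (hess f w').inverse (gradient f w') with hh
  have hh' : hess f w' h = gradient f w' := hH'.isInvertible.self_apply_inverse _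
  have hη' : energy (hess f w') h = newtonDecrement f w' := rfl
  set z := (hess f w).inverse (gradient f w) with hz
  have hz' : hess f w z = gradient f w := hH.isInvertible.self_apply_inverse _
  set δ := energy (hess f w) v with hδ
  set η := newtonDecrement f w with hη
  set a := δ / (1 + δ) with ha
  have ha0 : 0 ≤ a := by positivity
  have ha1 : a ≤ 1 / 7 := by rw [ha, div_le_iff₀ (by linarith)]; linarith
  have haη : a ^ 2 ≤ 6 / 49 * η := by
    -- Equivalent to `δ/(1+δ)² ≤ 6/49`, with equality at `δ = 1/6`.
    have h6 : (6 * δ - 1) * (δ - 6) ≥ 0 := by nlinarith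
    rw [ha, div_pow, div_le_iff₀ (by positivity)]
    nlinarith
  obtain ⟨hlow, hrem⟩ := abs_inner_gradient_sub_le hf hb w p h hpa ha1
  rw [← hww] at hlow hrem
  -- Since `1 - 1/(1+δ) = a`, the linear model of `f'(w')` splits into the PCG error and the damping
  -- error.
  have hsplit : inner ℝ h (gradient f w) + inner ℝ h (hess f w p) =
      inner ℝ h (hess f w (z - v)) + a * inner ℝ h (hess f w v) := by
    rw [hp, ← hz', map_smul, map_sub, inner_smul_right, inner_sub_right, ha]
    field_simp
    ring
  have b1 := hH.inner_le h (z - v)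
  have b2 := hH.inner_le h v
  have hE := energy_nonneg (hess f w) h
  have hmain : energy (hess f w') h ^ 2 ≤
      (beta * η + a * δ + 21 / 8 * a ^ 2) * energy (hess f w) h := by
    rw [hH'.energy_sq, hh']
    have b3 := mul_le_mul_of_nonneg_left b2 ha0
    have b4 := mul_le_mul_of_nonneg_left hres hE
    linarith [(abs_le.1 hrem).2]
  -- `1/20 + 1/7 + (21/8)(6/49) = 36/70`. The change of local norm adds the factor `9/7`, and
  -- `324/490 < 7/10`.
  have hc : beta * η + a * δ + 21 / 8 * a ^ 2 ≤ 36 / 70 * η := by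
    have : a * δ ≤ 1 / 7 * η := mul_le_mul ha1 hδη hδ0 (by norm_num)
    rw [beta]
    linarith
  have hη0 : 0 ≤ η := newtonDecrement_nonneg _ _
  have hη'0 := newtonDecrement_nonneg f w'
  rw [hη'] at hmain hlow
  have hfin : newtonDecrement f w' ^ 2 ≤ (7 / 10 * η) * newtonDecrement f w' := by
    calc _ ≤ 36 / 70 * η * energy (hess f w) h :=
          hmain.trans (mul_le_mul_of_nonneg_right hc hE)
      _ ≤ 36 / 70 * η * (9 / 7 * newtonDecrement f w') := by gcongr
      _ ≤ (7 / 10 * η) * newtonDecrement f w' := by nlinarith [mul_nonneg hη0 hη'0]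
  by_contra! hlt
  nlinarith

end DampedNewton
/-! ### Bounds on `ω` -/

lemma omega_nonneg {t : ℝ} (ht : 0 ≤ t) : 0 ≤ omega t := by
  have := Real.log_le_sub_one_of_pos (show 0 < 1 + t by linarith)
  rw [omega]; linarith

lemma omega_pos {t : ℝ} (ht : 0 < t) : 0 < omega t := by
  have := Real.log_lt_sub_one_of_pos (show 0 < 1 + t by linarith) (by linarith)
  rw [omega]; linarith

lemma omega_mono {s t : ℝ} (hs : 0 ≤ s) (hst : s ≤ t) : omega s ≤ omega t := by
  have h := Real.log_le_sub_one_of_pos (show 0 < (1 + t) / (1 + s) by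
    have : 0 < 1 + s := by linarith
    have : 0 < 1 + t := by linarith
    positivity)
  rw [Real.log_div (by linarith) (by linarith)] at h
  have h1 : (1 + t) / (1 + s) ≤ 1 + (t - s) := by
    rw [div_le_iff₀ (by linarith)]
    nlinarith
  rw [omega, omega]
  linarith

lemma omega_one_sixth_ge : 1 / 100 ≤ omega (1 / 6) := by
  have h : Real.log (1 + 1 / 6) ≤ 0.155 := by
    rw [Real.log_le_iff_le_exp (by norm_num)]
    refine le_trans ?_ (Real.quadratic_le_exp_of_nonneg (by norm_num))
    norm_num
  rw [omega]
  norm_num at h ⊢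
  linarith

lemma omega_one_sixth_le : omega (1 / 6) ≤ 1 / 78 := by
  have h := Real.le_log_one_add_of_nonneg (show (0 : ℝ) ≤ 1 / 6 by norm_num)
  rw [omega]
  norm_num at h ⊢
  linarith

/-- The threshold `19/120 = (1 - β)/6` is the least `δ` possible when `η ≥ 1/6`. -/
lemma half_omega_one_sixth_le {t : ℝ} (ht : 19 / 120 ≤ t) : 1 / 2 * omega (1 / 6) ≤ omega t := by
  refine le_trans ?_ (omega_mono (by norm_num) ht)
  have h : Real.log (1 + 19 / 120) ≤ 0.15 := by
    rw [Real.log_le_iff_le_exp (by norm_num)]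
    refine le_trans ?_ (Real.quadratic_le_exp_of_nonneg (by norm_num))
    norm_num
  have h2 := omega_one_sixth_le
  have h3 : (19 : ℝ) / 120 - 0.15 ≤ omega (19 / 120) := by rw [omega]; linarith
  norm_num at h3
  linarith

lemma neg_sub_log_one_sub_le {t : ℝ} (ht : 0 ≤ t) (ht' : t ≤ 1 / 6) :
    -t - Real.log (1 - t) ≤ 7 / 10 * t ^ 2 := by
  have h := Real.abs_log_sub_add_sum_range_le (x := t) (by rw [abs_of_nonneg ht]; linarith) 2
  rw [abs_of_nonneg ht] at h
  norm_num [Finset.sum_range_succ] at h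
  have h1 : t ^ 3 / (1 - t) ≤ 1 / 5 * t ^ 2 := by
    rw [div_le_iff₀ (by linarith)]
    nlinarith [sq_nonneg t]
  linarith [(abs_le.1 h).1]

/-- The difference of the two sides increases up to `1/2` and then decreases, so only the endpoints
matter. At `0.68` it is `1.1424 - log(25/8)`, barely positive. -/
lemma neg_sub_log_one_sub_le_sq {t : ℝ} (ht : 0 ≤ t) (ht' : t ≤ 0.68) :
    -t - Real.log (1 - t) ≤ t ^ 2 := by
  have hd : ∀ s : ℝ, s < 1 → HasDerivAt (fun s : ℝ => s ^ 2 + s + Real.log (1 - s))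
      (s * (1 - 2 * s) / (1 - s)) s := fun s hs => by
    have h1 : 1 - s ≠ 0 := by linarith
    refine (((hasDerivAt_pow 2 s).add (hasDerivAt_id s)).add
      (((hasDerivAt_id s).const_sub 1).log h1)).congr_deriv ?_
    simp only [id_eq]
    field_simp
    push_cast
    ring
  suffices h : 0 ≤ t ^ 2 + t + Real.log (1 - t) by linarith
  rcases le_total t (1 / 2) with h | h
  · have hmono : MonotoneOn (fun s : ℝ => s ^ 2 + s + Real.log (1 - s)) (Set.Icc 0 (1 / 2)) := by
      refine monotoneOn_of_deriv_nonneg (convex_Icc _ _)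
        (fun s hs => (hd s (by linarith [hs.2])).continuousAt.continuousWithinAt)
        (fun s hs =>
          (hd s (by linarith [(interior_subset hs).2])).differentiableAt.differentiableWithinAt)
        fun s hs => ?_
      have hs' := interior_subset hs
      rw [(hd s (by linarith [hs'.2])).deriv]
      exact div_nonneg (mul_nonneg hs'.1 (by linarith [hs'.2])) (by linarith [hs'.2])
    simpa using hmono (Set.left_mem_Icc.2 (by norm_num)) ⟨ht, h⟩ ht
  · have hanti : AntitoneOn (fun s : ℝ => s ^ 2 + s + Real.log (1 - s)) (Set.Icc (1 / 2) 0.68) := by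
      refine antitoneOn_of_deriv_nonpos (convex_Icc _ _)
        (fun s hs => (hd s (by linarith [hs.2])).continuousAt.continuousWithinAt)
        (fun s hs =>
          (hd s (by linarith [(interior_subset hs).2])).differentiableAt.differentiableWithinAt)
        fun s hs => ?_
      have hs' := interior_subset hs
      rw [(hd s (by linarith [hs'.2])).deriv]
      exact div_nonpos_of_nonpos_of_nonneg
        (mul_nonpos_of_nonneg_of_nonpos (by linarith [hs'.1]) (by linarith [hs'.1]))
        (by linarith [hs'.2])
    refine le_trans ?_ (hanti ⟨h, ht'⟩ (Set.right_mem_Icc.2 (by norm_num)) ht')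
    have hlog : Real.log (25 / 8) ≤ 1.1424 := by
      rw [Real.log_le_iff_le_exp (by norm_num)]
      refine le_trans ?_ (Real.sum_le_exp_of_nonneg (by norm_num) 8)
      norm_num [Finset.sum_range_succ, Nat.factorial]
    have : Real.log (1 - 0.68) = -Real.log (25 / 8) := by
      rw [← Real.log_inv]; norm_num
    simp only [this]
    norm_num at hlog ⊢
    linarith

/-! ### The distributed oracles -/

section Oracles

variable {d m : ℕ} {f : Fin m → Vec d → ℝ}

lemma gradient_objective (hf : ∀ i, TwiceDifferentiable (f i)) (w : Vec d) :
    gradient (objective f) w = aggregate fun i => gradient (f i) w := by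
  have h : HasFDerivAt (objective f) ((m : ℝ)⁻¹ • ∑ i, fderiv ℝ (f i) w) w :=
    (HasFDerivAt.fun_sum fun i _ => ((hf i).differentiable w).hasFDerivAt).const_mul _
  simp only [gradient, aggregate, h.fderiv, map_smul, map_sum]

lemma hess_objective (hf : ∀ i, TwiceDifferentiable (f i)) (w u : Vec d) :
    hess (objective f) w u = aggregate fun i => hess (f i) w u := by
  have h0 : gradient (objective f) = fun w => aggregate fun i => gradient (f i) w :=
    funext (gradient_objective hf)
  have h : HasFDerivAt (fun w => aggregate fun i => gradient (f i) w)
      ((m : ℝ)⁻¹ • ∑ i, hess (f i) w) w :=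
    HasFDerivAt.const_smul (f' := ∑ i, hess (f i) w) (HasFDerivAt.fun_sum fun i _ =>
      ((hf i).differentiable_gradient w).hasFDerivAt) (m : ℝ)⁻¹
  rw [hess, h0, h.fderiv]
  simp [aggregate]

variable [NeZero m] {lam L μ : ℝ} {w : Vec d}

lemma inner_precond (f : Fin m → Vec d → ℝ) (μ : ℝ) (w x y : Vec d) :
    inner ℝ x (precond f μ w y) = inner ℝ x (hess (f 0) w y) + μ * inner ℝ x y := by
  simp [precond, inner_add_right, inner_smul_right]

lemma abs_inner_hess_sub_le (hP : ‖hess (f 0) w - hess (objective f) w‖ ≤ μ) (x : Vec d) :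
    |inner ℝ x (hess (f 0) w x) - inner ℝ x (hess (objective f) w x)| ≤ μ * ‖x‖ ^ 2 := by
  rw [← inner_sub_right, ← sub_apply]
  refine (abs_real_inner_le_norm _ _).trans ?_
  have := (hess (f 0) w - hess (objective f) w).le_of_opNorm_le hP x
  nlinarith [norm_nonneg x]

lemma le_inner_precond (hP : ‖hess (f 0) w - hess (objective f) w‖ ≤ μ) (x : Vec d) :
    inner ℝ x (hess (objective f) w x) ≤ inner ℝ x (precond f μ w x) := by
  rw [inner_precond, real_inner_self_eq_norm_sq]
  linarith [(abs_le.1 (abs_inner_hess_sub_le hP x)).1]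

/-- `P ⪯ H + 2μ I`, and `I ⪯ H/λ`. -/
lemma inner_precond_le (hb : HessianBounds (objective f) lam L) (hμ : 0 ≤ μ)
    (hP : ‖hess (f 0) w - hess (objective f) w‖ ≤ μ) (x : Vec d) :
    inner ℝ x (precond f μ w x) ≤ (1 + 2 * μ / lam) * inner ℝ x (hess (objective f) w x) := by
  rw [inner_precond, real_inner_self_eq_norm_sq]
  have h1 := (abs_le.1 (abs_inner_hess_sub_le hP x)).2
  have h2 := mul_le_mul_of_nonneg_left (hb.lower w x)
    (div_nonneg (mul_nonneg zero_le_two hμ) hb.pos.le)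
  have h3 : 2 * μ / lam * (lam * ‖x‖ ^ 2) = 2 * μ * ‖x‖ ^ 2 := by
    have := hb.pos.ne'
    field_simp
  linarith

/-- Positivity comes from `H ⪯ P`; the function of the master need not be convex. -/
lemma isSPD_precond (hf : ∀ i, TwiceDifferentiable (f i))
    (hH : IsSPD (hess (objective f) w)) (hP : ‖hess (f 0) w - hess (objective f) w‖ ≤ μ) :
    IsSPD (precond f μ w) where
  symm x y := by
    rw [inner_precond, inner_precond, (hf 0).hess_symm w x y, real_inner_comm x y]
  pos x hx := (hH.pos x hx).trans_le (le_inner_precond hP x)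

lemma IsSPD.inverse {E : Type*} [NormedAddCommGroup E] [InnerProductSpace ℝ E]
    [FiniteDimensional ℝ E] {H : E →L[ℝ] E} (hH : IsSPD H) : IsSPD H.inverse where
  symm := hH.inverse_symm
  pos x hx := by
    have h := hH.isInvertible.self_apply_inverse x
    have h0 : H.inverse x ≠ 0 := fun h0 => hx (by rw [← h, h0, map_zero])
    have := hH.pos _ h0
    rwa [h, real_inner_comm] at this

end Oracles

/-! ### One outer iteration -/

section OuterIteration

variable {d m : ℕ} [NeZero m] {f : Fin m → Vec d → ℝ} {wHat : Fin m → Vec d} {lam L μ : ℝ}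
  {w : Vec d}

lemma one_le_log (hlam : 0 < lam) (hL : lam ≤ L) : 1 ≤ Real.log (2 * L / (beta * lam)) := by
  have h40 : 40 ≤ 2 * L / (beta * lam) := by
    rw [beta, le_div_iff₀ (by positivity)]
    linarith
  rw [Real.le_log_iff_exp_le (by linarith)]
  linarith [Real.exp_one_lt_d9]

lemma one_le_sqrt (hlam : 0 < lam) (hμ : 0 ≤ μ) : 1 ≤ √(1 + 2 * μ / lam) := by
  rw [Real.one_le_sqrt]
  have : 0 ≤ 2 * μ / lam := by positivity
  linarith

/-- The number of iterations in a PCG run is at most this. -/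
noncomputable def pcgBound (lam L μ : ℝ) : ℕ :=
  ⌈√(1 + 2 * μ / lam) * Real.log (2 * L / (beta * lam))⌉₊

lemma one_le_pcgBound (hlam : 0 < lam) (hL : lam ≤ L) (hμ : 0 ≤ μ) : 1 ≤ pcgBound lam L μ := by
  rw [pcgBound, Nat.one_le_ceil_iff]
  have h1 := one_le_log hlam hL
  have h2 := one_le_sqrt hlam hμ
  positivity

open Classical in
lemma pcgStep_of_residual (hf : ∀ i, TwiceDifferentiable (f i)) (halt : ℝ → Prop) (tol : ℝ)
    {v r s u v' r' s' : Vec d} {a : ℝ} (wHat : Fin m → Vec d)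
    (ha : a = inner ℝ r s / inner ℝ u (hess (objective f) w u))
    (hv' : v' = v + a • u) (hr' : r' = r - a • hess (objective f) w u)
    (hs' : s' = (precond f μ w).inverse r') :
    round f wHat lam L μ halt (.inner w tol v r s u) =
      if ‖r'‖ ≤ tol then
        if halt (energy (hess (objective f) w) v') then .done (dampedStep (objective f) w v')
        else .outer (dampedStep (objective f) w v')
      else .inner w tol v' r' s' (s' + (inner ℝ r' s' / inner ℝ r s) • u) := by
  -- The two products of the round give `H v'` by linearity, so `δ` needs no further communication.
  have hδ : √(inner ℝ v' (hess (objective f) w v) + a * inner ℝ v' (hess (objective f) w u)) =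
      energy (hess (objective f) w) v' := by
    rw [energy]
    nth_rw 4 [hv']
    rw [map_add, map_smul, inner_add_right, inner_smul_right]
  rw [← inner_smul_right] at hδ
  simp only [round, ← hess_objective hf, pcgStep, ← ha, ← hv', ← hr', ← hs', ← inner_smul_right, hδ]
  rfl

lemma round_outer (hf : ∀ i, TwiceDifferentiable (f i)) (halt : ℝ → Prop) :
    round f wHat lam L μ halt (.outer w) =
      .inner w (beta * √(lam / L) * ‖gradient (objective f) w‖) 0 (gradient (objective f) w)
        ((precond f μ w).inverse (gradient (objective f) w))
        ((precond f μ w).inverse (gradient (objective f) w)) := by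
  simp only [round, ← gradient_objective hf]

open Classical in
/-- An outer iteration takes at most `1 + pcgBound` rounds, and computes a damped Newton step
with an approximate Newton direction, whatever the stopping test is. -/
lemma exists_iterate_round_outer (wHat : Fin m → Vec d) (hf : ∀ i, TwiceDifferentiable (f i))
    (hsc : IsStandardSelfConcordant (objective f)) (hb : HessianBounds (objective f) lam L)
    (hμ : 0 ≤ μ) (hP : ‖hess (f 0) w - hess (objective f) w‖ ≤ μ) :
    ∃ n ≤ pcgBound lam L μ, ∃ v, IsApproxNewton (objective f) lam L w v ∧
      ∀ halt : ℝ → Prop, (round f wHat lam L μ halt)^[n + 1] (.outer w) =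
        if halt (energy (hess (objective f) w) v) then .done (dampedStep (objective f) w v)
        else .outer (dampedStep (objective f) w v) := by
  have hN := one_le_pcgBound hb.pos hb.le hμ
  have hH := hb.isSPD hsc.contDiff w
  have hPs := isSPD_precond hf hH hP
  have hQ := hPs.inverse
  have hκ : 1 ≤ 1 + 2 * μ / lam := by
    have := hb.pos
    have : 0 ≤ 2 * μ / lam := by positivity
    linarith
  set F := objective f with hF
  set g := gradient F w with hg
  set H := hess F w with hHdef
  set tol := beta * √(lam / L) * ‖g‖ with htol
  have htol0 : 0 ≤ tol := by rw [htol, beta]; positivity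
  rcases eq_or_ne g 0 with hg0 | hg0
  · refine ⟨1, hN, 0, ⟨by simp [← hg, hg0], by simp [← hg, hg0]⟩, fun halt => ?_⟩
    -- With zero gradient the step size is `0/0 = 0`, and the one obligatory iteration ends with `0
    -- ≤ tol`.
    rw [Function.iterate_succ_apply', Function.iterate_one, round_outer hf,
      pcgStep_of_residual hf halt _ (v' := 0) (r' := 0) (s' := 0) (a := 0)]
    · rw [if_pos (by rw [norm_zero]; exact htol0)]
    · rw [← hF, ← hg, hg0]; simp
    · simp
    · rw [← hF, ← hg, hg0]; simp
    · simp
  -- After `j` iterations PCG has ended, or it still carries the Galerkin invariants with residual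
  -- above `tol`. The guard `1 ≤ j` reflects that no test precedes the first iteration. The
  -- direction `v` does not depend on `halt`, which is consulted only after PCG ends.
  have claim : ∀ j : ℕ, (∃ n ≤ j, ∃ v, IsApproxNewton F lam L w v ∧
      ∀ halt : ℝ → Prop, (round f wHat lam L μ halt)^[n + 1] (.outer w) =
        if halt (energy H v) then .done (dampedStep F w v) else .outer (dampedStep F w v)) ∨
      ∃ v r u K, IsGalerkin H (precond f μ w).inverse g j v r K ∧
        IsConjugate H (precond f μ w).inverse g r u K ∧ r ≠ 0 ∧ (1 ≤ j → tol < ‖r‖) ∧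
        ∀ halt : ℝ → Prop, (round f wHat lam L μ halt)^[j + 1] (.outer w) =
          .inner w tol v r ((precond f μ w).inverse r) u := by
    intro j
    induction j with
    | zero =>
      exact Or.inr ⟨0, g, _, ⊥, isGalerkin_zero _ _ _, isConjugate_zero _ _ _, hg0, by simp,
        fun halt => round_outer (wHat := wHat) hf halt⟩
    | succ j ih =>
      rcases ih with ⟨n, hn, h⟩ | ⟨v, r, u, K, hG, hC, hr, -, hrun⟩
      · exact Or.inl ⟨n, hn.trans j.le_succ, h⟩
      have hG' := hG.step hH hQ hC hr rfl
      have hC' := hC.step hH hQ hG hr rfl rfl rfl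
      have hstep := fun halt => pcgStep_of_residual (lam := lam) (L := L) (μ := μ) (w := w) hf halt
        tol (v := v) (r := r) (s := (precond f μ w).inverse r) (u := u) wHat rfl rfl rfl rfl
      set a := inner ℝ r ((precond f μ w).inverse r) / inner ℝ u (H u) with ha
      by_cases hle : ‖r - a • H u‖ ≤ tol
      · refine Or.inl ⟨j + 1, le_rfl, v + a • u, ⟨?_, ?_⟩, fun halt => ?_⟩
        · rw [← hG'.residual]; exact hle
        · rw [← hG'.residual]; exact hG'.orth _ hG'.mem
        · rw [Function.iterate_succ_apply', hrun, hstep]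
          exact if_pos hle
      · refine Or.inr ⟨v + a • u, r - a • H u, _, _, hG', hC', ?_, fun _ => not_le.1 hle,
          fun halt => ?_⟩
        · intro h0
          rw [h0, norm_zero] at hle
          exact hle htol0
        · rw [Function.iterate_succ_apply', hrun, hstep]
          exact if_neg hle
  rcases claim (pcgBound lam L μ) with h | ⟨v, r, u, K, hG, hC, hr, htolr, hrun⟩
  · exact h
  · exfalso
    refine absurd (htolr hN) (not_lt.2 ?_)
    exact hG.norm_residual_le hH hPs hκ hb.pos hb.le (by norm_num [beta]) (hb.lower w) (hb.upper w)
      (le_inner_precond hP) (inner_precond_le hb hμ hP) (Nat.le_ceil _)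

end OuterIteration
/-! ### The outer loop -/

section OuterLoop

variable {d m : ℕ} [NeZero m] {f : Fin m → Vec d → ℝ} {wHat : Fin m → Vec d} {lam L μ : ℝ}
  {wStar : Vec d} {ε : ℝ} {halt : ℝ → Prop}

/-- After `k` outer iterations both the run that never stops and the run with the stopping test
`halt` hold an outer iterate with property `p`, or the latter has found a solution. -/
def Progress (f : Fin m → Vec d → ℝ) (wHat : Fin m → Vec d) (lam L μ : ℝ) (wStar : Vec d)
    (ε : ℝ) (halt : ℝ → Prop) (k : ℕ) (p : Vec d → Prop) : Prop :=
  ∃ T ≤ 1 + k * (pcgBound lam L μ + 1),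
    (∃ w, run f wHat lam L μ neverStop T = .outer w ∧ run f wHat lam L μ halt T = .outer w ∧ p w) ∨
    ∃ w, (run f wHat lam L μ halt T).iterate = some w ∧ objective f w - objective f wStar < ε

lemma progress_zero {p : Vec d → Prop} (hp : p (aggregate wHat)) :
    Progress f wHat lam L μ wStar ε halt 0 p :=
  ⟨1, by simp, Or.inl ⟨aggregate wHat, rfl, rfl, hp⟩⟩

lemma Progress.mono {k : ℕ} {p q : Vec d → Prop}
    (h : Progress f wHat lam L μ wStar ε halt k p) (hpq : ∀ w, p w → q w) :
    Progress f wHat lam L μ wStar ε halt k q := by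
  obtain ⟨T, hT, ⟨w, h1, h2, hw⟩ | h⟩ := h
  · exact ⟨T, hT, Or.inl ⟨w, h1, h2, hpq w hw⟩⟩
  · exact ⟨T, hT, Or.inr h⟩

/-- The bound on `μ` is assumed along the run that never stops. The two runs agree until `halt`
holds, so it serves both; at the stop `hgood` concludes. -/
lemma Progress.succ (hf : ∀ i, TwiceDifferentiable (f i))
    (hsc : IsStandardSelfConcordant (objective f)) (hb : HessianBounds (objective f) lam L)
    (hμ : 0 ≤ μ)
    (hP : ∀ (T : ℕ) (w : Vec d), (run f wHat lam L μ neverStop T).iterate = some w →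
      ‖hess (f 0) w - hess (objective f) w‖ ≤ μ)
    (hgood : ∀ w v, IsApproxNewton (objective f) lam L w v →
      halt (energy (hess (objective f) w) v) →
      objective f (dampedStep (objective f) w v) - objective f wStar < ε)
    {k : ℕ} {p q : Vec d → Prop} (h : Progress f wHat lam L μ wStar ε halt k p)
    (hpq : ∀ w v, p w → IsApproxNewton (objective f) lam L w v →
      q (dampedStep (objective f) w v)) :
    Progress f wHat lam L μ wStar ε halt (k + 1) q := by
  obtain ⟨T, hT, ⟨w, h1, h2, hw⟩ | h⟩ := h
  · obtain ⟨n, hn, v, hv, hrun⟩ :=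
      exists_iterate_round_outer wHat hf hsc hb hμ (hP T w (by rw [h1]; rfl))
    have hadv : ∀ halt : ℝ → Prop, run f wHat lam L μ halt T = .outer w →
        run f wHat lam L μ halt (n + 1 + T) =
          (round f wHat lam L μ halt)^[n + 1] (.outer w) := fun halt h => by
      rw [run, Function.iterate_add_apply]
      exact congrArg _ h
    refine ⟨n + 1 + T, by linarith, ?_⟩
    rw [hadv _ h1, hadv _ h2, hrun, hrun, if_neg (show ¬ neverStop _ from id)]
    by_cases hs : halt (energy (hess (objective f) w) v)
    · rw [if_pos hs]
      exact Or.inr ⟨_, rfl, hgood w v hv hs⟩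
    · rw [if_neg hs]
      exact Or.inl ⟨_, rfl, rfl, hpq w v hw hv⟩
  · exact ⟨T, by linarith, Or.inr h⟩

/-- The bound for the number of outer iterations. -/
noncomputable def outerBound (gap ε : ℝ) : ℕ :=
  ⌈gap / (1 / 2 * omega (1 / 6))⌉₊ + ⌈Real.logb 2 (2 * omega (1 / 6) / ε)⌉₊

/-- The complexity bound, for every stopping test that is passed only by good outputs. -/
lemma findsWithin_of_stop (hf : ∀ i, TwiceDifferentiable (f i))
    (hsc : IsStandardSelfConcordant (objective f)) (hb : HessianBounds (objective f) lam L)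
    (hμ : 0 ≤ μ)
    (hP : ∀ (T : ℕ) (w : Vec d), (run f wHat lam L μ neverStop T).iterate = some w →
      ‖hess (f 0) w - hess (objective f) w‖ ≤ μ)
    (hε : 0 < ε)
    (hgood : ∀ w v, IsApproxNewton (objective f) lam L w v →
      halt (energy (hess (objective f) w) v) →
      objective f (dampedStep (objective f) w v) - objective f wStar < ε) :
    FindsWithin (run f wHat lam L μ halt) (objective f) wStar ε
      (1 + outerBound (objective f (aggregate wHat) - objective f wStar) ε *
        (2 + √(1 + 2 * μ / lam) * Real.log (2 * L / (beta * lam)))) := by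
  set F := objective f with hF
  set gap := F (aggregate wHat) - F wStar with hgap
  have hω := omega_one_sixth_ge
  set ω := omega (1 / 6) with hωdef
  have hdec : ∀ w v, IsApproxNewton F lam L w v → F (dampedStep F w v) ≤ F w := fun w v hv => by
    have h1 := hv.apply_dampedStep_le hsc hb
    have h2 := omega_nonneg (energy_nonneg (hess F w) v)
    linarith
  -- Each step with `η > 1/6` gains `ω(1/6)/2`; the region `η ≤ 1/6` is never left.
  have stage1 : ∀ k : ℕ, Progress f wHat lam L μ wStar ε halt k fun w =>
      newtonDecrement F w ≤ 1 / 6 ∨ F w - F wStar ≤ gap - k * (1 / 2 * ω) := by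
    intro k
    induction k with
    | zero => exact progress_zero (Or.inr (by simp [hgap]))
    | succ k ih =>
      refine ih.succ hf hsc hb hμ hP hgood fun w v hw hv => ?_
      rcases le_or_gt (newtonDecrement F w) (1 / 6) with hn | hn
      · left
        linarith [hv.newtonDecrement_dampedStep_le hsc hb hn, newtonDecrement_nonneg F w]
      · right
        have h1 := hw.resolve_left (not_le.2 hn)
        have h2 := hv.apply_dampedStep_le hsc hb
        have h3 : 19 / 120 ≤ energy (hess F w) v := by
          refine le_trans ?_ (hv.le_energy hb hsc.contDiff)
          rw [beta]
          linarith
        have h4 := half_omega_one_sixth_le h3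
        push_cast
        linarith
  set N₁ := ⌈gap / (1 / 2 * ω)⌉₊ with hN₁
  set N₂ := ⌈Real.logb 2 (2 * ω / ε)⌉₊ with hN₂
  -- The square of the decrement halves because `(7/10)² < 1/2`. The other alternative, a gap of at
  -- most zero, persists by monotonicity of `f`.
  have stage2 : ∀ j : ℕ, Progress f wHat lam L μ wStar ε halt (N₁ + j) fun w =>
      newtonDecrement F w ^ 2 ≤ (1 / 2) ^ j / 36 ∨ F w - F wStar ≤ 0 := by
    intro j
    induction j with
    | zero =>
      refine (stage1 N₁).mono fun w hw => hw.imp (fun h => ?_) fun h => ?_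
      · have := newtonDecrement_nonneg F w
        norm_num
        nlinarith
      · have h1 := Nat.le_ceil (gap / (1 / 2 * ω))
        rw [div_le_iff₀ (by linarith)] at h1
        linarith
    | succ j ih =>
      refine ih.succ hf hsc hb hμ hP hgood fun w v hw hv => hw.imp (fun h => ?_) fun h => ?_
      · have h0 := newtonDecrement_nonneg F w
        have hj : ((1 : ℝ) / 2) ^ j ≤ 1 := pow_le_one₀ (by norm_num) (by norm_num)
        have hn : newtonDecrement F w ≤ 1 / 6 := by nlinarith
        have h1 : newtonDecrement F (dampedStep F w v) ^ 2 ≤ (7 / 10 * newtonDecrement F w) ^ 2 :=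
          pow_le_pow_left₀ (newtonDecrement_nonneg _ _)
            (hv.newtonDecrement_dampedStep_le hsc hb hn) 2
        have h2 : ((1 : ℝ) / 2) ^ (j + 1) = (1 / 2) ^ j * (1 / 2) := pow_succ _ _
        rw [mul_pow] at h1
        change newtonDecrement F (dampedStep F w v) ^ 2 ≤ _
        rw [h2]
        linarith [sq_nonneg (newtonDecrement F w)]
      · linarith [hdec w v hv]
  obtain ⟨T, hT, h⟩ := stage2 N₂
  refine ⟨T, ?_, ?_⟩
  · have h1 : (pcgBound lam L μ : ℝ) ≤
        √(1 + 2 * μ / lam) * Real.log (2 * L / (beta * lam)) + 1 := by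
      refine (Nat.ceil_lt_add_one (mul_nonneg (Real.sqrt_nonneg _) ?_)).le
      linarith [one_le_log hb.pos hb.le]
    have h2 : (T : ℝ) ≤ 1 + (N₁ + N₂ : ℕ) * (pcgBound lam L μ + 1) := by exact_mod_cast hT
    refine h2.trans ?_
    have h3 : outerBound gap ε = N₁ + N₂ := rfl
    rw [h3]
    have h4 : (0 : ℝ) ≤ (N₁ + N₂ : ℕ) := Nat.cast_nonneg _
    linarith [mul_le_mul_of_nonneg_left h1 h4]
  · rcases h with ⟨w, -, h2, hw⟩ | h
    · refine ⟨w, by rw [h2]; rfl, ?_⟩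
      rcases hw with hw | hw
      · have h0 := newtonDecrement_nonneg F w
        have hj : ((1 : ℝ) / 2) ^ N₂ ≤ 1 := pow_le_one₀ (by norm_num) (by norm_num)
        have hn : newtonDecrement F w ≤ 1 / 6 := by nlinarith
        have h3 := (apply_sub_le hsc hb w wStar (by linarith)).trans (neg_sub_log_one_sub_le h0 hn)
        have h4 : 2 * ω / ε ≤ 2 ^ N₂ := by
          have := (Real.logb_le_iff_le_rpow one_lt_two (by positivity)).1
            (Nat.le_ceil (Real.logb 2 (2 * ω / ε)))
          rwa [Real.rpow_natCast] at this
        rw [div_le_iff₀ hε] at h4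
        have h5 : ((1 : ℝ) / 2) ^ N₂ * (2 * ω) ≤ ε := by
          calc ((1 : ℝ) / 2) ^ N₂ * (2 * ω) ≤ (1 / 2) ^ N₂ * (2 ^ N₂ * ε) := by gcongr
            _ = ε := by rw [← mul_assoc, ← mul_pow]; norm_num
        have h6 : 0 < ((1 : ℝ) / 2) ^ N₂ := by positivity
        -- The gap is at most `(7/10)(1/36) 2^(-N₂)`, and `7/360 < 1/50 ≤ 2 ω(1/6)`.
        nlinarith
      · linarith
    · exact h

/-- The stopping criterion `δ ≤ (1 - β) √ε` is passed only by good outputs. -/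
lemma apply_dampedStep_sub_lt {F : Vec d → ℝ} (hsc : IsStandardSelfConcordant F)
    (hb : HessianBounds F lam L) (hε : 0 < ε) (hε' : ε ≤ 0.68 ^ 2) {w v : Vec d}
    (hv : IsApproxNewton F lam L w v) (hs : stopTest ε (energy (hess F w) v)) (y : Vec d) :
    F (dampedStep F w v) - F y < ε := by
  have h0 := newtonDecrement_nonneg F w
  have h1 := hv.le_energy hb hsc.contDiff
  have hbeta : (0 : ℝ) < 1 - beta := by norm_num [beta]
  have h2 : newtonDecrement F w ≤ √ε := le_of_mul_le_mul_left (h1.trans hs) hbeta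
  have h3 : √ε ≤ 0.68 := Real.sqrt_le_iff.2 ⟨by norm_num, hε'⟩
  have h4 := (apply_sub_le hsc hb w y (by norm_num at h3; linarith)).trans
    (neg_sub_log_one_sub_le_sq h0 (h2.trans h3))
  have h5 := hv.apply_dampedStep_le hsc hb
  -- The bound `η² ≤ ε` at `w` is not strict. Strictness comes from the decrease `ω(δ) > 0` of the
  -- last step, or from `η = 0`.
  rcases h0.eq_or_lt with h | h
  · have := omega_nonneg (energy_nonneg (hess F w) v)
    rw [← h] at h4
    linarith
  · have := omega_pos (lt_of_lt_of_le (mul_pos hbeta h) h1)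
    have h6 := pow_le_pow_left₀ h0 h2 2
    rw [Real.sq_sqrt hε.le] at h6
    linarith

end OuterLoop

/-- From `ω(1/6) ≥ 1/100` the first ceiling is at most `200 gap + 1`. From `2 ω(1/6) ≤ 1` and `1/log
2 ≤ 2` the second is at most `2M + 1`. Finally `2 + X ≤ 3X` and `1 ≤ M X`, so `600 gap + 13 M` is
the true coefficient of `X`. -/
lemma roundBound_le {gap ε X : ℝ} (hgap : 0 ≤ gap) (hε : 0 < ε) (hX : 1 ≤ X) :
    1 + (outerBound gap ε : ℝ) * (2 + X) ≤ 700 * (gap + max 1 (Real.log (1 / ε))) * X := by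
  have hω := omega_one_sixth_ge
  have hω' := omega_one_sixth_le
  set M := max 1 (Real.log (1 / ε)) with hM
  have hM1 : 1 ≤ M := le_max_left _ _
  have h1 : (⌈gap / (1 / 2 * omega (1 / 6))⌉₊ : ℝ) ≤ 200 * gap + 1 := by
    refine (Nat.ceil_lt_add_one (by positivity)).le.trans ?_
    gcongr
    rw [div_le_iff₀ (by linarith)]
    nlinarith
  have h2 : (⌈Real.logb 2 (2 * omega (1 / 6) / ε)⌉₊ : ℝ) ≤ 2 * M + 1 := by
    have h3 : Real.logb 2 (2 * omega (1 / 6) / ε) ≤ 2 * M := by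
      have hlog2 := Real.log_two_gt_d9
      rw [Real.logb, div_le_iff₀ (by linarith)]
      have h4 : Real.log (2 * omega (1 / 6) / ε) ≤ Real.log (1 / ε) :=
        Real.log_le_log (by positivity) (by gcongr; linarith)
      have h5 : Real.log (1 / ε) ≤ M := le_max_right _ _
      nlinarith
    calc (⌈Real.logb 2 (2 * omega (1 / 6) / ε)⌉₊ : ℝ) ≤ ⌈2 * M⌉₊ := by
          exact_mod_cast Nat.ceil_mono h3
      _ ≤ 2 * M + 1 := (Nat.ceil_lt_add_one (by linarith)).le
  have h3 : (outerBound gap ε : ℝ) ≤ 200 * gap + 4 * M := by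
    rw [outerBound]; push_cast; linarith
  calc 1 + (outerBound gap ε : ℝ) * (2 + X) ≤ M * X + (200 * gap + 4 * M) * (3 * X) := by
        gcongr
        · nlinarith
        · linarith
    _ ≤ 700 * (gap + M) * X := by
        have := mul_nonneg hgap (zero_le_one.trans hX)
        have := mul_nonneg (zero_le_one.trans hM1) (zero_le_one.trans hX)
        nlinarith

end DiSCO

theorem theorem3 :
    ∃ C : ℝ, 0 < C ∧
      ∀ (d m : ℕ) [NeZero m] (f : Fin m → DiSCO.Vec d → ℝ) (lam L ρ μ : ℝ)
        (wHat : Fin m → DiSCO.Vec d) (wStar : DiSCO.Vec d),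
        (∀ i, DiSCO.TwiceDifferentiable (f i)) →
        DiSCO.IsStandardSelfConcordant (DiSCO.objective f) →
        DiSCO.HessianBounds (DiSCO.objective f) lam L →
        IsMinOn (DiSCO.objective f) Set.univ wStar →
        0 ≤ ρ → 0 ≤ μ →
        (∀ i, IsMinOn (fun w => f i w + ρ / 2 * ‖w‖ ^ 2) Set.univ (wHat i)) →
        (∀ (T : ℕ) (w : DiSCO.Vec d),
          (DiSCO.run f wHat lam L μ DiSCO.neverStop T).iterate = some w →
            ‖DiSCO.hess (f 0) w - DiSCO.hess (DiSCO.objective f) w‖ ≤ μ) →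
        ∀ ε : ℝ, 0 < ε →
          let gap : ℝ := DiSCO.objective f (DiSCO.aggregate wHat) - DiSCO.objective f wStar
          let B : ℝ :=
            1 + ((⌈gap / (1 / 2 * DiSCO.omega (1 / 6))⌉₊ : ℝ)
                  + (⌈Real.logb 2 (2 * DiSCO.omega (1 / 6) / ε)⌉₊ : ℝ))
                * (2 + √(1 + 2 * μ / lam) * Real.log (2 * L / (DiSCO.beta * lam)))
          DiSCO.FindsWithin (DiSCO.run f wHat lam L μ DiSCO.neverStop)
              (DiSCO.objective f) wStar ε B ∧
            (ε ≤ 0.68 ^ 2 →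
              DiSCO.FindsWithin (DiSCO.run f wHat lam L μ (DiSCO.stopTest ε))
                (DiSCO.objective f) wStar ε B) ∧
            B ≤ C * (gap + max 1 (Real.log (1 / ε))) * √(1 + 2 * μ / lam)
                  * Real.log (2 * L / (DiSCO.beta * lam)) := by
  refine ⟨700, by norm_num, ?_⟩
  intro d m _ f lam L ρ μ wHat wStar hf hsc hb hmin _ hμ _ hP ε hε gap B
  have hX1 := DiSCO.one_le_log hb.pos hb.le
  have hX2 := DiSCO.one_le_sqrt hb.pos hμ
  have hgap : 0 ≤ gap := sub_nonneg.2 (hmin (Set.mem_univ _))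
  have hB : B = 1 + (DiSCO.outerBound gap ε : ℝ) *
      (2 + √(1 + 2 * μ / lam) * Real.log (2 * L / (DiSCO.beta * lam))) := by
    rw [DiSCO.outerBound, Nat.cast_add]
  rw [hB]
  refine ⟨DiSCO.findsWithin_of_stop hf hsc hb hμ hP hε fun w v _ h => h.elim, fun hε' =>
    DiSCO.findsWithin_of_stop hf hsc hb hμ hP hε fun w v hv h =>
      DiSCO.apply_dampedStep_sub_lt hsc hb hε hε' hv h wStar, ?_⟩
  exact (DiSCO.roundBound_le hgap hε (one_le_mul_of_one_le_of_one_le hX2 hX1)).trans_eq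
    (by rw [mul_assoc _ (√_)])
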